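/- There are absolute constants $c>0$ and $C>0$ such that the following holds for all integers $d$, $m$ and $r\ge 1$. Let $A,N\in\mathbb{R}^{d\times m}$, $F\in\mathbb{R}^{d\times r}$ and $\widetilde A=A+N$, and suppose that $A=FW$ with $W=(I,K)\Pi$, where $I$ is the $r\times r$ identity matrix, $K\in\mathbb{R}^{r\times(m-r)}$ is entrywise nonnegative with every column sum at most $1$, $\Pi$ is an $m\times m$ permutation matrix, and $\operatorname{rank}F=r$. Let $\varepsilon=\|N\|_2$ (the matrix 2-norm), let $\sigma_{\max}(F)$ and $\sigma_{\min}(F)$ be the largest and the smallest of the singular values $\sigma_1\ge\dots\ge\sigma_r$ of $F$, and let $\kappa(F)=\sigma_{\max}(F)/\sigma_{\min}(F)$. If $$\varepsilon\le c\,\frac{\sigma_{\min}(F)}{r\sqrt r},$$ then the preconditioned successive projection algorithm below, on the input $(\widetilde A,r)$, returns a set $\mathcal I\subseteq\{1,\dots,m\}$ of $r$ indices that can be ordered as $\mathcal I(1),\dots,\mathcal I(r)$ so that $$\max_{1\le j\le r}\|\widetilde a_{\mathcal I(j)}-f_j\|_2\le C\,\kappa(F)\,\varepsilon ,$$ where $\widetilde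 a_i$ and $f_j$ are the columns of $\widetilde A$ and $F$. This holds whichever singular value decomposition, optimal solution and maximizing indices the algorithm uses; in particular each of its steps can be carried out. Preconditioned successive projection algorithm on $(\widetilde A,r)$: (1) take a singular value decomposition $\widetilde A=U\Sigma V^\top$ ($U\in\mathbb{R}^{d\times d}$ and $V\in\mathbb{R}^{m\times m}$ orthogonal, $\Sigma$ a $d\times m$ diagonal matrix with entries $\sigma_1\ge\sigma_2\ge\dots\ge0$) and put $P=\operatorname{diag}(\sigma_1,\dots,\sigma_r)(v_1,\dots,v_r)^\top\in\mathbb{R}^{r\times m}$, with $v_k$ the columns of $V$; (2) let $L^*$ be an optimal solution of the problem of minimizing $-\log\det L$ over the symmetric positive definite $r\times r$ matrices $L$ with $p_i^\top Lp_i\le1$ for every column $p_i$ of $P$; (3) put $S=(L^*)^{1/2}P$ and $\mathcal I=\emptyset$, and as long as $|\mathcal I|<r$ choose an index $i^*$ that maximizes $\|s_i\|_2^2$ over the columns $s_i$ of $S$, put $t=s_{i^*}$, replace $S$ by $(I-tt^\top/\|t\|_2^2)S$ and add $i^*$ to $\mathcal I$; return $\mathcal I$. -/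

import Mathlib

namespace PrecondSPA

noncomputable section

/-- The `j`-th column of a real matrix, as a vector with the Euclidean norm. -/
def col {d m : ℕ} (M : Matrix (Fin d) (Fin m) ℝ) (j : Fin m) : EuclideanSpace ℝ (Fin d) :=
  WithLp.toLp 2 (fun i => M i j)

open scoped Matrix.Norms.L2Operator in
/-- The matrix 2-norm (operator norm for the Euclidean norms). -/
def specNorm {d m : ℕ} (M : Matrix (Fin d) (Fin m) ℝ) : ℝ := ‖M‖

/-- The largest singular value. -/
def sigmaMax {d m : ℕ} (M : Matrix (Fin d) (Fin m) ℝ) : ℝ :=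
  (Matrix.toEuclideanLin M).singularValues 0

/-- The smallest of the `min d m` singular values (Mathlib's sequence is in descending order and
indexed from `0`). -/
def sigmaMin {d m : ℕ} (M : Matrix (Fin d) (Fin m) ℝ) : ℝ :=
  (Matrix.toEuclideanLin M).singularValues (min d m - 1)

/-- The condition number. -/
def cond {d m : ℕ} (M : Matrix (Fin d) (Fin m) ℝ) : ℝ := sigmaMax M / sigmaMin M

/-- `A = F W` with `W = (I, K) Π` nonnegative, `F` of full column rank `r` and every column of `K`
of sum at most one. The bijection `e` places the columns of `(I, K)`: it plays the role of the
permutation matrix `Π`, and its existence forces `r ≤ m`. -/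
def SeparableWith {d m r : ℕ} (A : Matrix (Fin d) (Fin m) ℝ) (F : Matrix (Fin d) (Fin r) ℝ) :
    Prop :=
  F.rank = r ∧
  ∃ (K : Matrix (Fin r) (Fin (m - r)) ℝ) (e : Fin m ≃ Fin r ⊕ Fin (m - r)),
    (∀ k i, 0 ≤ K k i) ∧
    (∀ i, ∑ k, K k i ≤ 1) ∧
    A = F * (Matrix.fromCols (1 : Matrix (Fin r) (Fin r) ℝ) K).submatrix id e

/-! ### The successive projection algorithm -/

/-- `i` maximizes the squared norm of the columns of `S`. -/
def IsPivot {d m : ℕ} (S : Matrix (Fin d) (Fin m) ℝ) (i : Fin m) : Prop :=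
  ∀ k, ‖col S k‖ ^ 2 ≤ ‖col S i‖ ^ 2

/-- `S ← (I - t tᵀ / ‖t‖²) S` for the column `t = s_i`. -/
def projectOut {d m : ℕ} (S : Matrix (Fin d) (Fin m) ℝ) (i : Fin m) :
    Matrix (Fin d) (Fin m) ℝ :=
  (1 - (‖col S i‖ ^ 2)⁻¹ • Matrix.vecMulVec (fun a => S a i) (fun a => S a i)) * S

/-- `SPALoop r Q S I`: started in the state `(S, I)`, the loop of the successive projection
algorithm always stops, whichever maximizing index is chosen at each step, never divides by zero,
and every index set that it can output satisfies `Q`. -/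
inductive SPALoop {d m : ℕ} (r : ℕ) (Q : Finset (Fin m) → Prop) :
    Matrix (Fin d) (Fin m) ℝ → Finset (Fin m) → Prop
  | halt {S : Matrix (Fin d) (Fin m) ℝ} {I : Finset (Fin m)}
      (hI : r ≤ I.card) (hQ : Q I) : SPALoop r Q S I
  | step {S : Matrix (Fin d) (Fin m) ℝ} {I : Finset (Fin m)}
      (hI : I.card < r)
      (hex : ∃ i, IsPivot S i)
      (hne : ∀ i, IsPivot S i → col S i ≠ 0)
      (hnext : ∀ i, IsPivot S i → SPALoop r Q (projectOut S i) (insert i I)) :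
      SPALoop r Q S I

/-- The successive projection algorithm on the input `(A, r)` returns an index set that
satisfies `Q`, however ties are broken. -/
def SPAReturns {d m : ℕ} (A : Matrix (Fin d) (Fin m) ℝ) (r : ℕ) (Q : Finset (Fin m) → Prop) :
    Prop :=
  SPALoop r Q A ∅

/-! ### The preconditioned algorithm -/

/-- `A = U Σ Vᵀ` is a singular value decomposition: `U`, `V` are orthogonal and `Σ` is the `d × m`
diagonal matrix of the numbers `σ`, which are nonnegative and in descending order. -/
structure IsSVD {d m : ℕ} (A : Matrix (Fin d) (Fin m) ℝ) (U : Matrix (Fin d) (Fin d) ℝ)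
    (σ : Fin (min d m) → ℝ) (V : Matrix (Fin m) (Fin m) ℝ) : Prop where
  left_orthogonal : U ∈ Matrix.orthogonalGroup (Fin d) ℝ
  right_orthogonal : V ∈ Matrix.orthogonalGroup (Fin m) ℝ
  nonneg : ∀ k, 0 ≤ σ k
  antitone : Antitone σ
  eq_mul : A = U * (Matrix.of fun (i : Fin d) (j : Fin m) =>
    if h : i.val = j.val then σ ⟨i.val, lt_min i.isLt (h ▸ j.isLt)⟩ else 0) * V.transpose

/-- The `r × m` matrix `P = diag(σ₁, …, σ_r) (v₁, …, v_r)ᵀ`. -/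
def reduced {d m r : ℕ} (h : r ≤ min d m) (σ : Fin (min d m) → ℝ)
    (V : Matrix (Fin m) (Fin m) ℝ) : Matrix (Fin r) (Fin m) ℝ :=
  Matrix.diagonal (fun k : Fin r => σ (Fin.castLE h k)) *
    (V.submatrix id (Fin.castLE (h.trans (min_le_right d m)))).transpose

/-- Feasibility in the ellipsoid problem of the columns `p` of `P`:
`L` is positive definite and `pᵀ L p ≤ 1` for each of them. -/
def EllipsoidFeasible {r m : ℕ} (P : Matrix (Fin r) (Fin m) ℝ) (L : Matrix (Fin r) (Fin r) ℝ) :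
    Prop :=
  L.PosDef ∧ ∀ i, (fun a => P a i) ⬝ᵥ L.mulVec (fun a => P a i) ≤ 1

/-- `L` is an optimal solution of the problem of minimizing `-log det L` over the feasible `L`. -/
def EllipsoidOptimal {r m : ℕ} (P : Matrix (Fin r) (Fin m) ℝ) (L : Matrix (Fin r) (Fin r) ℝ) :
    Prop :=
  EllipsoidFeasible P L ∧
    ∀ L', EllipsoidFeasible P L' → -Real.log L.det ≤ -Real.log L'.det

open scoped MatrixOrder in
/-- The preconditioned successive projection algorithm on the input `(A, r)` returns an index set
that satisfies `Q`: each of its steps can be carried out, and the output satisfies `Q` whichever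
singular value decomposition, optimal solution and maximizing indices are used. -/
def PrecondSPAReturns {d m : ℕ} (A : Matrix (Fin d) (Fin m) ℝ) (r : ℕ)
    (Q : Finset (Fin m) → Prop) : Prop :=
  ∃ h : r ≤ min d m,
    (∃ U σ V, IsSVD A U σ V) ∧
    ∀ U σ V, IsSVD A U σ V →
      (∃ L, EllipsoidOptimal (reduced h σ V) L) ∧
      ∀ L, EllipsoidOptimal (reduced h σ V) L →
        SPAReturns (CFC.sqrt L * reduced h σ V) r Q

/-- The size of the basis error, `max_j ‖ã_{I(j)} - f_j‖₂`, of an ordering `j ↦ I(j)`. -/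
def basisError {d m r : ℕ} (A : Matrix (Fin d) (Fin m) ℝ) (F : Matrix (Fin d) (Fin r) ℝ)
    (idx : Fin r → Fin m) : ℝ :=
  ⨆ j, ‖col A (idx j) - col F j‖

end

end PrecondSPA

/-!
Let `P` be the truncation of the singular value decomposition of `Ã` to rank `r`. As `A` has rank
`r`, Eckart–Young bounds the discarded singular values by `ε`, so the columns of `P` have the
geometry of those of `Ã` up to `ε`. Hence, in the basis `G` formed by the `r` columns of `P` that
come from the columns of `F`, all columns of `P` lie within `δ = O(ε / σ_min(F))` of the solid
simplex, whose nonzero vertices occur exactly.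

Let `L` be optimal and `Q = Gᵀ L G`. The constraints at the columns of `G` give `tr Q ≤ r`, while
comparison of `L` with the feasible `(1 + δ)⁻² G⁻ᵀ G⁻¹` gives `-log det Q ≤ 2 r log (1 + δ)`. The
sum of `λ - 1 - log λ ≥ 0` over the eigenvalues of `Q` is therefore `O(r δ)`, which puts all of them
in `[1/2, 2]`: preconditioning leaves a well-conditioned image of a nearly simplicial point set.

Such an image is handled by successive projection. Projecting out columns that are close to the
images of some vertices almost kills these vertices and keeps the images of the others long and far
apart. By strict convexity of the ball, a combination of the vertices that is almost as long as the
longest vertex puts almost all its weight on a single one, so each pivot is `O(δ)`-close to a new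
vertex.
-/

namespace PrecondSPA

open Matrix Submodule

section InnerProductSpace

variable {ι E : Type*} [NormedAddCommGroup E] [InnerProductSpace ℝ E]

lemma norm_add_le_of_le_norm_sub {x y : E} {μ ρ : ℝ} (hμ : 0 < μ) (hx : ‖x‖ ≤ μ) (hy : ‖y‖ ≤ μ)
    (hρ : 0 ≤ ρ) (hxy : ρ ≤ ‖x - y‖) : ‖x + y‖ ≤ 2 * μ - ρ ^ 2 / (4 * μ) := by
  have hparallelogram := parallelogram_law_with_norm ℝ x y
  have hρμ : ρ ≤ 2 * μ := by linarith [norm_sub_le x y]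
  have hnonneg : 0 ≤ 2 * μ - ρ ^ 2 / (4 * μ) := by
    rw [sub_nonneg, div_le_iff₀ (by positivity)]
    nlinarith
  refine abs_le_of_sq_le_sq' ?_ hnonneg |>.2
  have hsq : ‖x + y‖ ^ 2 ≤ 4 * μ ^ 2 - ρ ^ 2 := by
    nlinarith [norm_nonneg x, norm_nonneg y]
  have hexpand : (2 * μ - ρ ^ 2 / (4 * μ)) ^ 2 = 4 * μ ^ 2 - ρ ^ 2 + (ρ ^ 2 / (4 * μ)) ^ 2 := by
    field_simp
    ring
  linarith [sq_nonneg (ρ ^ 2 / (4 * μ))]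

lemma inner_le_of_inner_le_of_le_norm_sub {x y e : E} {μ ρ : ℝ} (hμ : 0 < μ) (hx : ‖x‖ ≤ μ)
    (hy : ‖y‖ ≤ μ) (hρ : 0 ≤ ρ) (hxy : ρ ≤ ‖x - y‖) (he : ‖e‖ = 1)
    (hle : inner ℝ x e ≤ inner ℝ y e) : inner ℝ x e ≤ μ - ρ ^ 2 / (8 * μ) := by
  have hadd : inner ℝ x e + inner ℝ y e ≤ 2 * μ - ρ ^ 2 / (4 * μ) := by
    rw [← inner_add_left]
    refine (real_inner_le_norm _ _).trans ?_
    rw [he, mul_one]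
    exact norm_add_le_of_le_norm_sub hμ hx hy hρ hxy
  have hhalf : ρ ^ 2 / (4 * μ) = 2 * (ρ ^ 2 / (8 * μ)) := by
    field_simp
    ring
  linarith

lemma sum_mul_le_sub_gap_mul [Fintype ι] {w a : ι → ℝ} {μ g : ℝ} {j : ι}
    (hw : ∀ k, 0 ≤ w k) (hsum : ∑ k, w k ≤ 1) (hgμ : g ≤ μ) (haj : a j ≤ μ)
    (ha : ∀ k, k ≠ j → a k ≤ μ - g) : ∑ k, w k * a k ≤ μ - g * (1 - w j) := by
  classical
  rw [← Finset.add_sum_erase _ _ (Finset.mem_univ j)] at hsum ⊢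
  have hrest : ∑ k ∈ Finset.univ.erase j, w k * a k
      ≤ (∑ k ∈ Finset.univ.erase j, w k) * (μ - g) := by
    rw [Finset.sum_mul]
    exact Finset.sum_le_sum fun k hk =>
      mul_le_mul_of_nonneg_left (ha k (Finset.ne_of_mem_erase hk)) (hw k)
  nlinarith [mul_le_mul_of_nonneg_left haj (hw j)]

lemma exists_dominant_weight [Fintype ι] {z : ι → E} {w : ι → ℝ} {J : Finset ι}
    {μ ρ θ : ℝ} (hw : ∀ j, 0 ≤ w j) (hsum : ∑ j, w j ≤ 1) (hz : ∀ j, ‖z j‖ ≤ μ)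
    (hJ : ∀ j ∈ J, ‖z j‖ ≤ μ / 2) (hρ : 0 < ρ) (hρμ : ρ ≤ 2 * μ)
    (hsep : ∀ j ∉ J, ∀ k ∉ J, j ≠ k → ρ ≤ ‖z j - z k‖) (hθ : θ < μ / 2)
    (hlarge : μ - θ ≤ ‖∑ j, w j • z j‖) :
    ∃ j ∉ J, (1 - w j) * ρ ^ 2 ≤ 8 * μ * θ := by
  have hμ : 0 < μ := by linarith
  set v := ∑ j, w j • z j with hv
  have hvpos : 0 < ‖v‖ := by linarith
  set e : E := ‖v‖⁻¹ • v with he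
  have he1 : ‖e‖ = 1 := norm_smul_inv_norm (norm_pos_iff.mp hvpos)
  set a : ι → ℝ := fun j => inner ℝ (z j) e with ha
  have hav : ∑ j, w j * a j = ‖v‖ := by
    calc ∑ j, w j * a j = inner ℝ v e := by simp only [ha, hv, sum_inner, real_inner_smul_left]
      _ = ‖v‖ := by
        rw [he, real_inner_smul_right, real_inner_self_eq_norm_sq]
        field_simp
  have haz (j : ι) : a j ≤ ‖z j‖ := by simpa [he1] using real_inner_le_norm (z j) e
  have : Nonempty ι := by
    by_contra! h
    simp [hv] at hvpos
  obtain ⟨j, hj⟩ := Finite.exists_max a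
  have haj : ‖v‖ ≤ a j := by
    have hle : ‖v‖ ≤ (∑ k, w k) * a j := by
      rw [← hav, Finset.sum_mul]
      exact Finset.sum_le_sum fun k _ => mul_le_mul_of_nonneg_left (hj k) (hw k)
    have hsum0 : 0 ≤ ∑ k, w k := Finset.sum_nonneg fun k _ => hw k
    have : 0 < a j := pos_of_mul_pos_right (hvpos.trans_le hle) hsum0
    exact hle.trans (mul_le_of_le_one_left this.le hsum)
  have hjJ : j ∉ J := fun h => by linarith [haz j, hJ j h]
  have hgap : ρ ^ 2 / (8 * μ) ≤ μ / 2 := by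
    rw [div_le_iff₀ (by positivity)]
    nlinarith
  have hgapped (k : ι) (hk : k ≠ j) : a k ≤ μ - ρ ^ 2 / (8 * μ) := by
    by_cases hkJ : k ∈ J
    · linarith [haz k, hJ k hkJ]
    · exact inner_le_of_inner_le_of_le_norm_sub hμ (hz k) (hz j) hρ.le (hsep k hkJ j hjJ hk) he1
        (hj k)
  refine ⟨j, hjJ, ?_⟩
  have hbound : ρ ^ 2 / (8 * μ) * (1 - w j) ≤ θ := by
    linarith [sum_mul_le_sub_gap_mul hw hsum (by linarith) ((haz j).trans (hz j)) hgapped]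
  rw [div_mul_eq_mul_div, div_le_iff₀ (by positivity)] at hbound
  linarith

lemma half_norm_le_norm_sub_sum {e u : ι → E} (he : Orthonormal ℝ e) {J : Finset ι}
    {x : E} (hx : ∀ j ∈ J, inner ℝ x (e j) = 0) {β : ℝ} (hβ : 0 ≤ β)
    (hu : ∀ j ∈ J, ‖u j - e j‖ ≤ β) (hβJ : β * √J.card ≤ 1 / 2) (y : ι → ℝ) :
    ‖x‖ / 2 ≤ ‖x - ∑ j ∈ J, y j • u j‖ := by
  set Y := ∑ j ∈ J, y j • e j with hY
  have hYnorm : ‖Y‖ ^ 2 = ∑ j ∈ J, y j ^ 2 := by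
    rw [← real_inner_self_eq_norm_sq, hY, he.inner_sum]
    simp [sq]
  have hl1 : ∑ j ∈ J, |y j| ≤ √J.card * ‖Y‖ := by
    refine abs_le_of_sq_le_sq' ?_ (by positivity) |>.2
    rw [mul_pow, hYnorm, Real.sq_sqrt (Nat.cast_nonneg _)]
    simpa only [sq_abs] using sq_sum_le_card_mul_sum_sq (s := J) (f := fun j => |y j|)
  have hsmall : ‖∑ j ∈ J, y j • (u j - e j)‖ ≤ ‖Y‖ / 2 :=
    calc ‖∑ j ∈ J, y j • (u j - e j)‖ ≤ ∑ j ∈ J, |y j| * β := by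
          refine norm_sum_le_of_le _ fun j hj => ?_
          rw [norm_smul, Real.norm_eq_abs]
          exact mul_le_mul_of_nonneg_left (hu j hj) (abs_nonneg _)
      _ ≤ √J.card * ‖Y‖ * β := by
          rw [← Finset.sum_mul]
          exact mul_le_mul_of_nonneg_right hl1 hβ
      _ ≤ ‖Y‖ / 2 := by nlinarith [norm_nonneg Y]
  have hpyth : ‖x - Y‖ ^ 2 = ‖x‖ ^ 2 + ‖Y‖ ^ 2 := by
    have horth : inner ℝ x Y = 0 := by
      rw [hY, inner_sum]
      exact Finset.sum_eq_zero fun j hj => by rw [real_inner_smul_right, hx j hj, mul_zero]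
    rw [norm_sub_sq_real, horth]
    ring
  have hxle : ‖x‖ ≤ ‖x - Y‖ := by
    refine abs_le_of_sq_le_sq' ?_ (norm_nonneg _) |>.2
    linarith [sq_nonneg ‖Y‖]
  have hYle : ‖Y‖ ≤ ‖x - Y‖ := by
    refine abs_le_of_sq_le_sq' ?_ (norm_nonneg _) |>.2
    linarith [sq_nonneg ‖x‖]
  have hsplit : x - ∑ j ∈ J, y j • u j = (x - Y) - ∑ j ∈ J, y j • (u j - e j) := by
    simp only [smul_sub, Finset.sum_sub_distrib, hY]
    abel
  rw [hsplit]
  linarith [norm_sub_norm_le (x - Y) (∑ j ∈ J, y j • (u j - e j))]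

lemma starProjection_orthogonal_sup_span_singleton (K : Submodule ℝ E) (s x : E)
    [K.HasOrthogonalProjection] [(K ⊔ ℝ ∙ s).HasOrthogonalProjection] :
    (K ⊔ ℝ ∙ s)ᗮ.starProjection x = Kᗮ.starProjection x -
      ((‖Kᗮ.starProjection s‖ ^ 2)⁻¹ *
        inner ℝ (Kᗮ.starProjection s) (Kᗮ.starProjection x)) • Kᗮ.starProjection s := by
  set t := Kᗮ.starProjection s with ht
  set c := (‖t‖ ^ 2)⁻¹ * inner ℝ t (Kᗮ.starProjection x) with hc
  have hs : s - t ∈ K := by simp [ht, starProjection_orthogonal_val]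
  have htK : t ∈ Kᗮ := starProjection_apply_mem _ _
  have hctK : Kᗮ.starProjection x - c • t ∈ Kᗮ :=
    Kᗮ.sub_mem (starProjection_apply_mem _ _) (Kᗮ.smul_mem _ htK)
  have hct : inner ℝ t (Kᗮ.starProjection x - c • t) = 0 := by
    rw [inner_sub_right, real_inner_smul_right, real_inner_self_eq_norm_sq, hc]
    rcases eq_or_ne t 0 with h0 | h0
    · simp [h0]
    · have : ‖t‖ ≠ 0 := norm_ne_zero_iff.mpr h0
      field_simp
      ring
  refine eq_starProjection_of_mem_orthogonal (K := (K ⊔ ℝ ∙ s)ᗮ) ?_ ?_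
  · rw [← inf_orthogonal]
    refine ⟨hctK, mem_orthogonal_singleton_iff_inner_right.mpr ?_⟩
    rw [← sub_add_cancel s t, inner_add_left, hct, hctK _ hs, add_zero]
  · have hx : x - Kᗮ.starProjection x ∈ K := by simp [starProjection_orthogonal_val]
    have htsup : t ∈ K ⊔ ℝ ∙ s := by
      rw [← sub_sub_cancel s t]
      exact sub_mem (mem_sup_right (mem_span_singleton_self s)) (mem_sup_left hs)
    rw [← sub_add]
    exact le_orthogonal_orthogonal _ (add_mem (mem_sup_left hx) (smul_mem _ c htsup))

end InnerProductSpace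

section NearSimplex

variable {ι κ : Type*} [Fintype ι]

lemma norm_le_sum_abs (x : EuclideanSpace ℝ ι) : ‖x‖ ≤ ∑ j, |x j| := by
  refine abs_le_of_sq_le_sq' ?_ (Finset.sum_nonneg fun j _ => abs_nonneg _) |>.2
  rw [EuclideanSpace.norm_sq_eq]
  exact Finset.sum_sq_le_sq_sum_of_nonneg fun j _ => norm_nonneg (x j)

variable (ι) in
/-- The convex hull of the origin and of the standard basis: the coefficient vectors that a column
of `(I, K) Π` may have. -/
def solidSimplex : Set (EuclideanSpace ℝ ι) :=
  {w | (∀ j, 0 ≤ w j) ∧ ∑ j, w j ≤ 1}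

lemma norm_le_one_of_mem_solidSimplex {w : EuclideanSpace ℝ ι} (hw : w ∈ solidSimplex ι) :
    ‖w‖ ≤ 1 := by
  refine (norm_le_sum_abs w).trans ?_
  simpa only [abs_of_nonneg (hw.1 _)] using hw.2

variable [DecidableEq ι]

lemma norm_sub_single_le_of_mem_solidSimplex {w : EuclideanSpace ℝ ι} (hw : w ∈ solidSimplex ι)
    (j : ι) : ‖w - EuclideanSpace.single j 1‖ ≤ 2 * (1 - w j) := by
  have hsum := hw.2
  rw [← Finset.add_sum_erase _ _ (Finset.mem_univ j)] at hsum
  have hj : |(w - EuclideanSpace.single j (1 : ℝ)) j| = 1 - w j := by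
    have : 0 ≤ ∑ k ∈ Finset.univ.erase j, w k := Finset.sum_nonneg fun k _ => hw.1 k
    rw [PiLp.sub_apply, PiLp.single_apply, if_pos rfl, abs_sub_comm, abs_of_nonneg (by linarith)]
  have hne : ∑ k ∈ Finset.univ.erase j, |(w - EuclideanSpace.single j (1 : ℝ)) k|
      = ∑ k ∈ Finset.univ.erase j, w k :=
    Finset.sum_congr rfl fun k hk => by
      simp [Finset.ne_of_mem_erase hk, abs_of_nonneg (hw.1 k)]
  refine (norm_le_sum_abs _).trans ?_
  rw [← Finset.add_sum_erase _ _ (Finset.mem_univ j), hj, hne]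
  linarith

/-- The points `q i` lie within `δ` of the solid simplex, and the vertex `e_j` occurs among them, at
the index `v j`. -/
structure IsNearSimplex (q : κ → EuclideanSpace ℝ ι) (v : ι → κ) (δ : ℝ) : Prop where
  near : ∀ i, ∃ w ∈ solidSimplex ι, ‖q i - w‖ ≤ δ
  vertex : ∀ j, q (v j) = EuclideanSpace.single j 1

namespace IsNearSimplex

variable {q : κ → EuclideanSpace ℝ ι} {v : ι → κ} {δ : ℝ}

lemma injective (h : IsNearSimplex q v δ) : Function.Injective v := by
  intro j k hjk
  have hsingle := (h.vertex j).symm.trans ((congrArg q hjk).trans (h.vertex k))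
  by_contra hne
  simpa [hne] using congrArg (fun x : EuclideanSpace ℝ ι => x j) hsingle

lemma norm_le (h : IsNearSimplex q v δ) (i : κ) : ‖q i‖ ≤ 1 + δ := by
  obtain ⟨w, hw, hqw⟩ := h.near i
  linarith [norm_le_insert w (q i), norm_sub_rev w (q i), norm_le_one_of_mem_solidSimplex hw]

end IsNearSimplex

end NearSimplex

section Deflation

variable {ι κ E : Type*} [Fintype ι] [DecidableEq ι] [NormedAddCommGroup E] [InnerProductSpace ℝ E]

/-- `Φ` is what a well-conditioned map becomes once the coordinates in `J` have been projected out: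
it almost kills them and is still well conditioned on the others. -/
structure IsDeflation (J : Finset ι) (Φ : EuclideanSpace ℝ ι →ₗ[ℝ] E) : Prop where
  lower : ∀ x : EuclideanSpace ℝ ι, (∀ j ∈ J, x j = 0) → ‖x‖ / 4 ≤ ‖Φ x‖
  upper : ∀ x, ‖Φ x‖ ≤ 2 * ‖x‖
  small : ∀ j ∈ J, ‖Φ (EuclideanSpace.single j 1)‖ ≤ 1 / 8

namespace IsDeflation

variable {J : Finset ι} {Φ : EuclideanSpace ℝ ι →ₗ[ℝ] E}

lemma le_norm_single (h : IsDeflation J Φ) {j : ι} (hj : j ∉ J) :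
    1 / 4 ≤ ‖Φ (EuclideanSpace.single j 1)‖ := by
  simpa using h.lower (EuclideanSpace.single j 1) fun k hk => by
    simp [ne_of_mem_of_not_mem hk hj]

lemma le_norm_single_sub_single (h : IsDeflation J Φ) {j k : ι} (hj : j ∉ J) (hk : k ∉ J)
    (hjk : j ≠ k) :
    1 / 4 ≤ ‖Φ (EuclideanSpace.single j 1) - Φ (EuclideanSpace.single k 1)‖ := by
  rw [← map_sub]
  refine le_trans ?_ (h.lower _ fun l hl => by
    simp [ne_of_mem_of_not_mem hl hj, ne_of_mem_of_not_mem hl hk])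
  have hcoord := PiLp.norm_apply_le (EuclideanSpace.single j (1 : ℝ) - EuclideanSpace.single k 1) j
  simp only [PiLp.sub_apply, PiLp.single_apply, if_true, if_neg hjk, sub_zero,
    norm_one] at hcoord
  linarith

lemma exists_norm_sub_single_le (h : IsDeflation J Φ) {q : κ → EuclideanSpace ℝ ι} {v : ι → κ}
    {δ : ℝ} (hq : IsNearSimplex q v δ) (hδ : δ ≤ 1 / 20000) (hJ : J ≠ Finset.univ) {i : κ}
    (hi : ∀ k, ‖Φ (q k)‖ ≤ ‖Φ (q i)‖) :
    Φ (q i) ≠ 0 ∧ ∃ j ∉ J, ‖q i - EuclideanSpace.single j 1‖ ≤ 1026 * δ := by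
  obtain ⟨w, hw, hqw⟩ := hq.near i
  have hδ0 : 0 ≤ δ := (norm_nonneg _).trans hqw
  set μ := ‖Φ (q i)‖
  have hvertex (j : ι) : ‖Φ (EuclideanSpace.single j 1)‖ ≤ μ := hq.vertex j ▸ hi (v j)
  obtain ⟨l, hl⟩ : ∃ l, l ∉ J := by simpa [Finset.eq_univ_iff_forall] using hJ
  have hμ4 : 1 / 4 ≤ μ := (h.le_norm_single hl).trans (hvertex l)
  have hμ2 : μ ≤ 2 * (1 + δ) := (h.upper _).trans (by linarith [hq.norm_le i])
  have hΦw : Φ w = ∑ j, w j • Φ (EuclideanSpace.single j 1) := by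
    conv_lhs => rw [← (EuclideanSpace.basisFun ι ℝ).sum_repr w]
    simp
  have hlarge : μ - 2 * δ ≤ ‖∑ j, w j • Φ (EuclideanSpace.single j 1)‖ := by
    have hdiff : ‖Φ (q i) - Φ w‖ ≤ 2 * δ := by
      rw [← map_sub]
      exact (h.upper _).trans (by linarith)
    rw [← hΦw]
    linarith [norm_le_insert (Φ w) (Φ (q i)), norm_sub_rev (Φ w) (Φ (q i))]
  obtain ⟨j, hjJ, hj⟩ := exists_dominant_weight hw.1 hw.2 hvertex
    (fun j hj => (h.small j hj).trans (by linarith)) (by norm_num : (0 : ℝ) < 1 / 4) (by linarith)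
    (fun j hj k hk => h.le_norm_single_sub_single hj hk) (by linarith) hlarge
  refine ⟨norm_pos_iff.mp (by linarith), j, hjJ, ?_⟩
  calc ‖q i - EuclideanSpace.single j 1‖ ≤ ‖q i - w‖ + ‖w - EuclideanSpace.single j 1‖ :=
        norm_sub_le_norm_sub_add_norm_sub _ _ _
    _ ≤ δ + 2 * (1 - w j) := add_le_add hqw (norm_sub_single_le_of_mem_solidSimplex hw j)
    -- `μ ≤ 2 * (1 + δ)` and `ρ = 1 / 4`, `θ = 2 * δ` give `1 - w j ≤ 512 * (1 + δ) * δ`.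
    _ ≤ 1026 * δ := by nlinarith

end IsDeflation

lemma isDeflation_starProjection_orthogonal [FiniteDimensional ℝ E]
    {H : EuclideanSpace ℝ ι →ₗ[ℝ] E} {J : Finset ι}
    {u : ι → EuclideanSpace ℝ ι} {η : ℝ} (hlower : ∀ x, ‖x‖ / 2 ≤ ‖H x‖)
    (hupper : ∀ x, ‖H x‖ ≤ 2 * ‖x‖) (hu : ∀ j ∈ J, ‖u j - EuclideanSpace.single j 1‖ ≤ η)
    (hη : 0 ≤ η) (hη16 : η ≤ 1 / 16) (hηJ : η * √J.card ≤ 1 / 2) :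
    IsDeflation J
      ((span ℝ ((fun j => H (u j)) '' (J : Set ι)))ᗮ.starProjection.toLinearMap ∘ₗ H) where
  lower x hx := by
    set K := span ℝ ((fun j => H (u j)) '' (J : Set ι))
    obtain ⟨y, hy⟩ :=
      (mem_span_image_finset_iff_exists_fun' ℝ).mp (K.starProjection_apply_mem (H x))
    have hres : Kᗮ.starProjection (H x) = H (x - ∑ j ∈ J, y j • u j) := by
      simp only [starProjection_orthogonal_val, ← hy, map_sub, map_sum, map_smul]
    have hhalf := half_norm_le_norm_sub_sum (EuclideanSpace.basisFun ι ℝ).orthonormal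
      (x := x) (fun j hj => by simpa [EuclideanSpace.inner_single_right] using hx j hj) hη
      (by simpa using hu) hηJ y
    change ‖x‖ / 4 ≤ ‖Kᗮ.starProjection (H x)‖
    rw [hres]
    linarith [hlower (x - ∑ j ∈ J, y j • u j)]
  upper x := (norm_starProjection_apply_le _ _).trans (hupper x)
  small j hj := by
    set K := span ℝ ((fun j => H (u j)) '' (J : Set ι))
    have hmem : H (u j) ∈ K := subset_span ⟨j, hj, rfl⟩
    have hzero : Kᗮ.starProjection (H (u j)) = 0 := by
      rw [starProjection_orthogonal_val, starProjection_eq_self_iff.mpr hmem, sub_self]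
    change ‖Kᗮ.starProjection (H (EuclideanSpace.single j 1))‖ ≤ 1 / 8
    calc ‖Kᗮ.starProjection (H (EuclideanSpace.single j 1))‖
        = ‖Kᗮ.starProjection (H (u j - EuclideanSpace.single j 1))‖ := by
          rw [map_sub, map_sub, hzero, zero_sub, norm_neg]
      _ ≤ 2 * ‖u j - EuclideanSpace.single j 1‖ :=
        (norm_starProjection_apply_le _ _).trans (hupper _)
      _ ≤ 1 / 8 := by linarith [hu j hj]

end Deflation

section SuccessiveProjection

variable {n d m r : ℕ}

lemma col_mul (M : Matrix (Fin n) (Fin d) ℝ) (S : Matrix (Fin d) (Fin m) ℝ) (i : Fin m) :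
    col (M * S) i = toEuclideanLin M (col S i) := by
  ext a
  simp [col, Matrix.mul_apply, mulVec, dotProduct]

lemma col_projectOut (S : Matrix (Fin d) (Fin m) ℝ) (i k : Fin m) :
    col (projectOut S i) k =
      col S k - ((‖col S i‖ ^ 2)⁻¹ * inner ℝ (col S i) (col S k)) • col S i := by
  ext a
  simp only [projectOut, col_mul, toLpLin_apply, Matrix.sub_mulVec, Matrix.one_mulVec,
    Matrix.smul_mulVec, vecMulVec_mulVec]
  simp [col, PiLp.inner_apply, dotProduct, mul_comm]
  ring

/-- The part of the `k`-th column of `S` orthogonal to the columns in `I`: the `k`-th column of the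
matrix that the algorithm has reached, from `S`, once it has selected `I`. -/
noncomputable def residual (S : Matrix (Fin d) (Fin m) ℝ) (I : Finset (Fin m)) (k : Fin m) :
    EuclideanSpace ℝ (Fin d) :=
  (span ℝ (col S '' I))ᗮ.starProjection (col S k)

lemma residual_empty (S : Matrix (Fin d) (Fin m) ℝ) (k : Fin m) : residual S ∅ k = col S k := by
  simp [residual, starProjection_top']

lemma residual_eq_zero_of_mem (S : Matrix (Fin d) (Fin m) ℝ) {I : Finset (Fin m)} {k : Fin m}
    (hk : k ∈ I) : residual S I k = 0 := by
  have hmem : col S k ∈ span ℝ (col S '' I) := subset_span ⟨k, hk, rfl⟩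
  rw [residual, starProjection_orthogonal_val, starProjection_eq_self_iff.mpr hmem, sub_self]

lemma residual_insert (S : Matrix (Fin d) (Fin m) ℝ) (I : Finset (Fin m)) (i k : Fin m) :
    residual S (insert i I) k = residual S I k -
      ((‖residual S I i‖ ^ 2)⁻¹ * inner ℝ (residual S I i) (residual S I k)) • residual S I i := by
  simp only [residual, Finset.coe_insert, Set.image_insert_eq, span_insert]
  rw [← starProjection_orthogonal_sup_span_singleton]
  congr! 3
  exact sup_comm _ _

lemma SPALoop.mono {Q Q' : Finset (Fin m) → Prop} (hQ : ∀ I, Q I → Q' I)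
    {S : Matrix (Fin d) (Fin m) ℝ} {I : Finset (Fin m)} (h : SPALoop r Q S I) :
    SPALoop r Q' S I := by
  induction h with
  | halt hI hQI => exact .halt hI (hQ _ hQI)
  | step hI hex hne _ ih => exact .step hI hex hne ih

lemma spaLoop_of_invariant {S T : Matrix (Fin d) (Fin m) ℝ} {Inv : Finset (Fin m) → Prop}
    {I : Finset (Fin m)} (hrm : r ≤ m) (hI : I.card ≤ r) (hInv : Inv I)
    (hT : ∀ k, col T k = residual S I k)
    (hstep : ∀ I i, I.card < r → Inv I → (∀ k, ‖residual S I k‖ ≤ ‖residual S I i‖) →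
      residual S I i ≠ 0 ∧ Inv (insert i I)) :
    SPALoop r (fun I => I.card = r ∧ Inv I) T I := by
  obtain hIr | hIr := hI.eq_or_lt
  · exact .halt hIr.ge ⟨hIr, hInv⟩
  have hpivot (i : Fin m) (hi : IsPivot T i) : residual S I i ≠ 0 ∧ Inv (insert i I) :=
    hstep I i hIr hInv fun k => by
      simpa only [hT] using (sq_le_sq₀ (norm_nonneg _) (norm_nonneg _)).mp (hi k)
  refine .step hIr ?_ (fun i hi => hT i ▸ (hpivot i hi).1) fun i hi => ?_
  · have : Nonempty (Fin m) := ⟨⟨0, by omega⟩⟩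
    exact Finite.exists_max fun k => ‖col T k‖ ^ 2
  · obtain ⟨hne, hInv'⟩ := hpivot i hi
    have hcard : (insert i I).card = I.card + 1 :=
      Finset.card_insert_of_notMem fun h => hne (residual_eq_zero_of_mem S h)
    refine spaLoop_of_invariant hrm (by omega) hInv' (fun k => ?_) hstep
    rw [col_projectOut, residual_insert, hT, hT]
termination_by r - I.card

variable {S : Matrix (Fin d) (Fin m) ℝ}
  {H : EuclideanSpace ℝ (Fin r) →ₗ[ℝ] EuclideanSpace ℝ (Fin d)}
  {q : Fin m → EuclideanSpace ℝ (Fin r)} {v : Fin r → Fin m} {δ : ℝ}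

lemma residual_ne_zero_and_exists_norm_sub_single_le (hq : IsNearSimplex q v δ)
    (hδ : δ * √r ≤ 1 / 20000) (hS : ∀ i, col S i = H (q i)) (hlower : ∀ x, ‖x‖ / 2 ≤ ‖H x‖)
    (hupper : ∀ x, ‖H x‖ ≤ 2 * ‖x‖) {J : Finset (Fin r)} {idx : Fin r → Fin m} (hJr : J.card < r)
    (hJ : ∀ j ∈ J, ‖q (idx j) - EuclideanSpace.single j 1‖ ≤ 1026 * δ) {i : Fin m}
    (hi : ∀ k, ‖residual S (J.image idx) k‖ ≤ ‖residual S (J.image idx) i‖) :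
    residual S (J.image idx) i ≠ 0 ∧
      ∃ j ∉ J, ‖q i - EuclideanSpace.single j 1‖ ≤ 1026 * δ := by
  have hδ0 : 0 ≤ δ := by
    obtain ⟨w, -, hw⟩ := hq.near i
    exact (norm_nonneg _).trans hw
  have hr : 1 ≤ √r := by
    rw [Real.one_le_sqrt]
    exact_mod_cast Nat.one_le_of_lt hJr
  have hsqrtJ : √J.card ≤ √r := Real.sqrt_le_sqrt (by exact_mod_cast hJr.le)
  have hdeflation := isDeflation_starProjection_orthogonal hlower hupper hJ (by linarith)
    (by nlinarith) (by nlinarith)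
  have hresidual (k : Fin m) : residual S (J.image idx) k =
      ((span ℝ ((fun j => H (q (idx j))) '' J))ᗮ.starProjection.toLinearMap ∘ₗ H) (q k) := by
    simp only [residual, Finset.coe_image, Set.image_image, hS]
    rfl
  simp only [hresidual] at hi ⊢
  exact hdeflation.exists_norm_sub_single_le hq (by nlinarith) (fun h => by simp [h] at hJr) hi

theorem spaReturns_of_isNearSimplex (hq : IsNearSimplex q v δ)
    (hδ : δ * √r ≤ 1 / 20000) (hS : ∀ i, col S i = H (q i)) (hlower : ∀ x, ‖x‖ / 2 ≤ ‖H x‖)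
    (hupper : ∀ x, ‖H x‖ ≤ 2 * ‖x‖) :
    SPAReturns S r fun I => ∃ idx : Fin r → Fin m, Function.Injective idx ∧
      Finset.univ.image idx = I ∧ ∀ j, ‖q (idx j) - EuclideanSpace.single j 1‖ ≤ 1026 * δ := by
  let Inv (I : Finset (Fin m)) : Prop := ∃ (J : Finset (Fin r)) (idx : Fin r → Fin m),
    J.image idx = I ∧ J.card = I.card ∧
      ∀ j ∈ J, ‖q (idx j) - EuclideanSpace.single j 1‖ ≤ 1026 * δ
  have hstep (I : Finset (Fin m)) (i : Fin m) (hI : I.card < r) (hInv : Inv I)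
      (hi : ∀ k, ‖residual S I k‖ ≤ ‖residual S I i‖) :
      residual S I i ≠ 0 ∧ Inv (insert i I) := by
    obtain ⟨J, idx, rfl, hcard, hJ⟩ := hInv
    obtain ⟨hne, j, hjJ, hj⟩ := residual_ne_zero_and_exists_norm_sub_single_le hq hδ hS hlower
      hupper (hcard ▸ hI) hJ hi
    have hi : i ∉ J.image idx := fun h => hne (residual_eq_zero_of_mem S h)
    have hupdate (k : Fin r) (hk : k ∈ J) : Function.update idx j i k = idx k :=
      Function.update_of_ne (ne_of_mem_of_not_mem hk hjJ) _ _
    refine ⟨hne, insert j J, Function.update idx j i, ?_, ?_, ?_⟩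
    · rw [Finset.image_insert, Function.update_self, Finset.image_congr hupdate]
    · rw [Finset.card_insert_of_notMem hjJ, Finset.card_insert_of_notMem hi, hcard]
    · rw [Finset.forall_mem_insert, Function.update_self]
      exact ⟨hj, fun k hk => (hupdate k hk).symm ▸ hJ k hk⟩
  have hrm : r ≤ m := by simpa using Fintype.card_le_of_injective v hq.injective
  refine (spaLoop_of_invariant hrm (by simp) ⟨∅, v, by simp⟩
    (fun k => (residual_empty S k).symm) hstep).mono fun I ⟨hIr, J, idx, hJI, hJcard, hJ⟩ => ?_
  obtain rfl : J = Finset.univ := by simp [← Finset.card_eq_iff_eq_univ, hJcard, hIr]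
  refine ⟨idx, ?_, hJI, fun j => hJ j (Finset.mem_univ j)⟩
  rw [← Set.injOn_univ, ← Finset.coe_univ, ← Finset.card_image_iff, hJI, hJcard]

end SuccessiveProjection

section LogDet

lemma inner_map_self_eq_sum {ι E : Type*} [Fintype ι] [NormedAddCommGroup E]
    [InnerProductSpace ℝ E] (b : OrthonormalBasis ι ℝ E) {T : E →ₗ[ℝ] E} {lam : ι → ℝ}
    (hb : ∀ i, T (b i) = lam i • b i) (x : E) :
    inner ℝ x (T x) = ∑ i, lam i * inner ℝ (b i) x ^ 2 := by
  have hTx : T x = ∑ i, (inner ℝ (b i) x * lam i) • b i := by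
    conv_lhs => rw [← b.sum_repr' x]
    simp [hb, smul_smul]
  rw [hTx, inner_sum]
  refine Finset.sum_congr rfl fun i _ => ?_
  rw [inner_smul_right, real_inner_comm]
  ring

-- `19 / 100` is just below `log 2 - 1 / 2`, the value of `x - 1 - log x` at `x = 1 / 2`.
lemma half_le_and_le_two_of_sub_log_le {x : ℝ} (hx : 0 < x)
    (h : x - 1 - Real.log x ≤ 19 / 100) : 1 / 2 ≤ x ∧ x ≤ 2 := by
  have hlog_gt := Real.log_two_gt_d9
  have hlog_lt := Real.log_two_lt_d9
  constructor
  · by_contra! hlt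
    have htangent := Real.log_le_sub_one_of_pos (x := 2 * x) (by positivity)
    rw [Real.log_mul (by norm_num) hx.ne'] at htangent
    linarith
  · by_contra! hlt
    have htangent := Real.log_le_sub_one_of_pos (x := x / 2) (by positivity)
    rw [Real.log_div hx.ne' (by norm_num)] at htangent
    linarith

variable {n : Type*} [Fintype n] [DecidableEq n]

lemma eigenvalues_bounds_of_trace_sub_log_det_le {Q : Matrix n n ℝ} (hQ : Q.PosDef)
    (h : Q.trace - Fintype.card n - Real.log Q.det ≤ 19 / 100) (i : n) :
    1 / 2 ≤ hQ.1.eigenvalues i ∧ hQ.1.eigenvalues i ≤ 2 := by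
  set lam := hQ.1.eigenvalues
  have hpos (i : n) : 0 < lam i := hQ.eigenvalues_pos i
  have htrace : Q.trace = ∑ i, lam i := by simpa using hQ.1.trace_eq_sum_eigenvalues
  have hlogdet : Real.log Q.det = ∑ i, Real.log (lam i) := by
    have : Q.det = ∏ i, lam i := by simpa using hQ.1.det_eq_prod_eigenvalues
    rw [this, Real.log_prod fun i _ => (hpos i).ne']
  have hsum : ∑ i, (lam i - 1 - Real.log (lam i)) ≤ 19 / 100 := by
    simpa [Finset.sum_sub_distrib, htrace, hlogdet] using h
  refine half_le_and_le_two_of_sub_log_le (hpos i) (le_trans ?_ hsum)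
  exact Finset.single_le_sum (f := fun i => lam i - 1 - Real.log (lam i))
    (fun j _ => by linarith [Real.log_le_sub_one_of_pos (hpos j)]) (Finset.mem_univ i)

lemma inner_toEuclideanLin_bounds_of_trace_sub_log_det_le {Q : Matrix n n ℝ} (hQ : Q.PosDef)
    (h : Q.trace - Fintype.card n - Real.log Q.det ≤ 19 / 100) (x : EuclideanSpace ℝ n) :
    ‖x‖ ^ 2 / 2 ≤ inner ℝ x (toEuclideanLin Q x) ∧
      inner ℝ x (toEuclideanLin Q x) ≤ 2 * ‖x‖ ^ 2 := by
  have hbounds := eigenvalues_bounds_of_trace_sub_log_det_le hQ h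
  have heigen (i : n) : toEuclideanLin Q (hQ.1.eigenvectorBasis i)
      = hQ.1.eigenvalues i • hQ.1.eigenvectorBasis i := by
    rw [toLpLin_apply, hQ.1.mulVec_eigenvectorBasis]
    rfl
  rw [inner_map_self_eq_sum _ heigen, ← hQ.1.eigenvectorBasis.sum_sq_inner_right x,
    Finset.sum_div, Finset.mul_sum]
  constructor <;> refine Finset.sum_le_sum fun i _ => ?_
  · rw [div_eq_inv_mul, ← one_div]
    exact mul_le_mul_of_nonneg_right (hbounds i).1 (sq_nonneg _)
  · exact mul_le_mul_of_nonneg_right (hbounds i).2 (sq_nonneg _)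

end LogDet

section Ellipsoid

lemma inner_toEuclideanLin_transpose_mul_self {n k : Type*} [Fintype n] [DecidableEq n] [Fintype k]
    (B : Matrix k n ℝ) (x : EuclideanSpace ℝ n) :
    inner ℝ x (toEuclideanLin (Bᵀ * B) x) = ‖toEuclideanLin B x‖ ^ 2 := by
  classical
  rw [toLpLin_mul_same, ← conjTranspose_eq_transpose_of_trivial,
    toEuclideanLin_conjTranspose_eq_adjoint, LinearMap.comp_apply, LinearMap.adjoint_inner_right,
    real_inner_self_eq_norm_sq]

lemma abs_apply_le_one_of_posSemidef {n : Type*} {M : Matrix n n ℝ}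
    (hM : M.PosSemidef) (hdiag : ∀ i, M i i ≤ 1) (i j : n) : |M i j| ≤ 1 := by
  have hminor := (hM.submatrix ![i, j]).det_nonneg
  have hsymm : M j i = M i j := by simpa using hM.1.apply i j
  simp only [det_fin_two, submatrix_apply, cons_val_zero, cons_val_one, hsymm] at hminor
  rw [← sq_le_one_iff_abs_le_one]
  nlinarith [hdiag i, hdiag j, hM.diag_nonneg (i := i), hM.diag_nonneg (i := j)]

open scoped MatrixOrder in
lemma transpose_sqrt_mul_sqrt {n : Type*} [Fintype n] [DecidableEq n] {L : Matrix n n ℝ}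
    (hL : L.PosSemidef) : (CFC.sqrt L)ᵀ * CFC.sqrt L = L := by
  have hsqrt : (CFC.sqrt L).PosSemidef := nonneg_iff_posSemidef.mp (CFC.sqrt_nonneg L)
  rw [← conjTranspose_eq_transpose_of_trivial, hsqrt.1.eq,
    CFC.sqrt_mul_sqrt_self L (nonneg_iff_posSemidef.mpr hL)]

variable {m r : ℕ} {P : Matrix (Fin r) (Fin m) ℝ}

lemma transpose_mul_mul_apply_self (P : Matrix (Fin r) (Fin m) ℝ) (L : Matrix (Fin r) (Fin r) ℝ)
    (i : Fin m) : (Pᵀ * L * P) i i = (fun a => P a i) ⬝ᵥ L *ᵥ (fun a => P a i) := by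
  rw [Matrix.mul_assoc]
  simp [mul_apply, dotProduct, mulVec]

lemma ellipsoidFeasible_transpose_mul_self_iff {B : Matrix (Fin r) (Fin r) ℝ} (hB : IsUnit B) :
    EllipsoidFeasible P (Bᵀ * B) ↔ ∀ i, ‖toEuclideanLin B (col P i)‖ ≤ 1 := by
  have hposDef : (Bᵀ * B).PosDef := by
    simpa using PosDef.conjTranspose_mul_self B (mulVec_injective_of_isUnit hB)
  have hcol (i : Fin m) : (fun a => P a i) ⬝ᵥ (Bᵀ * B) *ᵥ (fun a => P a i)
      = ‖toEuclideanLin B (col P i)‖ ^ 2 := by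
    rw [← inner_toEuclideanLin_transpose_mul_self, dotProduct_comm]
    rfl
  simp only [EllipsoidFeasible, hposDef, hcol, sq_le_one_iff₀ (norm_nonneg _), true_and]

lemma exists_ellipsoidFeasible (P : Matrix (Fin r) (Fin m) ℝ) : ∃ L, EllipsoidFeasible P L := by
  set s : ℝ := 1 + ∑ i, ‖col P i‖
  have hs0 : 0 < s := by positivity
  have hunit : IsUnit (s⁻¹ • (1 : Matrix (Fin r) (Fin r) ℝ)) :=
    isUnit_one.smul (Units.mk0 s⁻¹ (by positivity))
  refine ⟨_, (ellipsoidFeasible_transpose_mul_self_iff hunit).mpr fun i => ?_⟩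
  have hi : ‖col P i‖ ≤ ∑ k, ‖col P k‖ :=
    Finset.single_le_sum (fun k _ => norm_nonneg _) (Finset.mem_univ i)
  rw [map_smul, LinearMap.smul_apply, toLpLin_one, LinearMap.id_apply, norm_smul, norm_inv,
    Real.norm_of_nonneg hs0.le, inv_mul_le_one₀ hs0]
  linarith

lemma isCompact_posSemidef_feasible {R : Matrix (Fin m) (Fin r) ℝ} (hR : P * R = 1) :
    IsCompact {L : Matrix (Fin r) (Fin r) ℝ |
      L.PosSemidef ∧ ∀ i, (fun a => P a i) ⬝ᵥ L *ᵥ (fun a => P a i) ≤ 1} := by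
  have hclosed : IsClosed {L : Matrix (Fin r) (Fin r) ℝ |
      L.PosSemidef ∧ ∀ i, (fun a => P a i) ⬝ᵥ L *ᵥ (fun a => P a i) ≤ 1} := by
    simp only [posSemidef_iff_dotProduct_mulVec, IsHermitian,
      conjTranspose_eq_transpose_of_trivial, star_trivial, Set.ofPred_and, Set.ofPred_forall]
    refine .inter (.inter ?_ ?_) ?_
    · exact isClosed_eq (by fun_prop) continuous_id
    · exact isClosed_iInter fun x => isClosed_le continuous_const (by fun_prop)
    · exact isClosed_iInter fun x => isClosed_le (by fun_prop) continuous_const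
  have hbox : IsCompact (Set.pi Set.univ fun _ => Set.pi Set.univ fun _ => Set.Icc (-1) 1 :
      Set (Matrix (Fin m) (Fin m) ℝ)) :=
    isCompact_univ_pi fun _ => isCompact_univ_pi fun _ => isCompact_Icc
  have hcont : Continuous fun M : Matrix (Fin m) (Fin m) ℝ => Rᵀ * M * R := by fun_prop
  refine (hbox.image hcont).of_isClosed_subset hclosed ?_
  rintro L ⟨hL, hLP⟩
  refine ⟨Pᵀ * L * P, fun i _ j _ => abs_le.mp (abs_apply_le_one_of_posSemidef ?_ ?_ i j), ?_⟩
  · simpa using hL.conjTranspose_mul_mul_same P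
  · simpa only [transpose_mul_mul_apply_self] using hLP
  · calc Rᵀ * (Pᵀ * L * P) * R = (P * R)ᵀ * L * (P * R) := by
          simp only [transpose_mul, Matrix.mul_assoc]
      _ = L := by rw [hR, transpose_one, Matrix.one_mul, Matrix.mul_one]

theorem exists_ellipsoidOptimal {R : Matrix (Fin m) (Fin r) ℝ} (hR : P * R = 1) :
    ∃ L, EllipsoidOptimal P L := by
  obtain ⟨L₀, hL₀, hL₀P⟩ := exists_ellipsoidFeasible P
  obtain ⟨L, ⟨hL, hLP⟩, hmax⟩ := (isCompact_posSemidef_feasible hR).exists_isMaxOn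
    ⟨L₀, hL₀.posSemidef, hL₀P⟩ (f := Matrix.det) (by fun_prop)
  have hdet : 0 < L.det := hL₀.det_pos.trans_le (hmax ⟨hL₀.posSemidef, hL₀P⟩)
  refine ⟨L, ⟨hL.posDef_iff_det_ne_zero.mpr hdet.ne', hLP⟩, fun L' ⟨hL', hL'P⟩ => ?_⟩
  exact neg_le_neg (Real.log_le_log hL'.det_pos (hmax ⟨hL'.posSemidef, hL'P⟩))

variable {L G : Matrix (Fin r) (Fin r) ℝ}

lemma EllipsoidOptimal.neg_log_det_conj_le (hL : EllipsoidOptimal P L) (hG : IsUnit G) {s : ℝ}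
    (hs : 0 < s) (hGs : ∀ i, ‖toEuclideanLin G⁻¹ (col P i)‖ ≤ s) :
    -Real.log (Gᵀ * L * G).det ≤ 2 * r * Real.log s := by
  have hunit : IsUnit (s⁻¹ • G⁻¹) :=
    ((isUnit_nonsing_inv_iff).mpr hG).smul (Units.mk0 s⁻¹ (by positivity))
  have hfeasible := (ellipsoidFeasible_transpose_mul_self_iff (P := P) hunit).mpr fun i => by
    rw [map_smul, LinearMap.smul_apply, norm_smul, norm_inv, Real.norm_of_nonneg hs.le,
      inv_mul_le_one₀ hs]
    exact hGs i
  have hdet : G.det ≠ 0 := ((isUnit_iff_isUnit_det G).mp hG).ne_zero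
  have hle := hL.2 _ hfeasible
  have hlogB : Real.log ((s⁻¹ • G⁻¹)ᵀ * (s⁻¹ • G⁻¹)).det
      = -(2 * r * Real.log s) - 2 * Real.log G.det := by
    rw [det_mul, det_transpose, det_smul, det_nonsing_inv, Ring.inverse_eq_inv', Fintype.card_fin,
      ← sq, Real.log_pow, Real.log_mul (by positivity) (by positivity), Real.log_pow, Real.log_inv,
      Real.log_inv]
    push_cast
    ring
  have hlogQ : Real.log (Gᵀ * L * G).det = 2 * Real.log G.det + Real.log L.det := by
    rw [det_mul, det_mul, det_transpose, Real.log_mul (mul_ne_zero hdet hL.1.1.det_pos.ne') hdet,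
      Real.log_mul hdet hL.1.1.det_pos.ne']
    ring
  linarith

lemma trace_conj_submatrix_le_of_ellipsoidFeasible (hL : EllipsoidFeasible P L)
    (v : Fin r → Fin m) : ((P.submatrix id v)ᵀ * L * P.submatrix id v).trace ≤ r := by
  calc ((P.submatrix id v)ᵀ * L * P.submatrix id v).trace ≤ ∑ _ : Fin r, (1 : ℝ) :=
        Finset.sum_le_sum fun j _ => (transpose_mul_mul_apply_self _ _ _).trans_le (hL.2 (v j))
    _ = r := by simp

theorem EllipsoidOptimal.norm_factor_mul_bounds (hL : EllipsoidOptimal P L) {v : Fin r → Fin m}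
    (hv : IsUnit (P.submatrix id v)) {s : ℝ} (hs : 0 < s)
    (hPs : ∀ i, ‖toEuclideanLin (P.submatrix id v)⁻¹ (col P i)‖ ≤ s)
    (hrs : 2 * r * Real.log s ≤ 19 / 100) {B : Matrix (Fin r) (Fin r) ℝ} (hB : Bᵀ * B = L)
    (x : EuclideanSpace ℝ (Fin r)) :
    ‖x‖ / 2 ≤ ‖toEuclideanLin (B * P.submatrix id v) x‖ ∧
      ‖toEuclideanLin (B * P.submatrix id v) x‖ ≤ 2 * ‖x‖ := by
  set G := P.submatrix id v
  have hQ : (Gᵀ * L * G).PosDef := by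
    simpa using hL.1.1.conjTranspose_mul_mul_same (mulVec_injective_of_isUnit hv)
  have hgap : (Gᵀ * L * G).trace - Fintype.card (Fin r) - Real.log (Gᵀ * L * G).det ≤ 19 / 100 := by
    rw [Fintype.card_fin]
    linarith [hL.neg_log_det_conj_le hv hs hPs, trace_conj_submatrix_le_of_ellipsoidFeasible hL.1 v]
  obtain ⟨hlower, hupper⟩ := inner_toEuclideanLin_bounds_of_trace_sub_log_det_le hQ hgap x
  have hQB : Gᵀ * L * G = (B * G)ᵀ * (B * G) := by
    rw [← hB, transpose_mul]
    simp only [Matrix.mul_assoc]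
  rw [hQB, inner_toEuclideanLin_transpose_mul_self] at hlower hupper
  constructor
  · refine le_of_sq_le_sq ?_ (norm_nonneg _)
    linarith [sq_nonneg ‖x‖, div_pow ‖x‖ 2 2]
  · refine le_of_sq_le_sq ?_ (by positivity)
    linarith [sq_nonneg ‖x‖, mul_pow 2 ‖x‖ 2]

end Ellipsoid

section SingularValues

variable {E F : Type*} [NormedAddCommGroup E] [InnerProductSpace ℝ E] [FiniteDimensional ℝ E]
  [NormedAddCommGroup F] [InnerProductSpace ℝ F] [FiniteDimensional ℝ F] {n : ℕ}

/-- An orthonormal basis of right singular vectors of `T`, in the order of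
`LinearMap.singularValues`. -/
noncomputable def rightSingularBasis (T : E →ₗ[ℝ] F) (hn : Module.finrank ℝ E = n) :
    OrthonormalBasis (Fin n) ℝ E :=
  T.isSymmetric_adjoint_comp_self.eigenvectorBasis hn

lemma adjoint_comp_self_rightSingularBasis (T : E →ₗ[ℝ] F) (hn : Module.finrank ℝ E = n)
    (i : Fin n) : (T.adjoint ∘ₗ T) (rightSingularBasis T hn i) =
      T.singularValues i ^ 2 • rightSingularBasis T hn i := by
  rw [T.sq_singularValues_fin hn]
  exact T.isSymmetric_adjoint_comp_self.apply_eigenvectorBasis hn i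

lemma inner_map_rightSingularBasis (T : E →ₗ[ℝ] F) (hn : Module.finrank ℝ E = n) (i j : Fin n) :
    inner ℝ (T (rightSingularBasis T hn i)) (T (rightSingularBasis T hn j)) =
      if i = j then T.singularValues j ^ 2 else 0 := by
  rw [← LinearMap.adjoint_inner_right, ← LinearMap.comp_apply,
    adjoint_comp_self_rightSingularBasis, inner_smul_right,
    orthonormal_iff_ite.mp (rightSingularBasis T hn).orthonormal, mul_ite, mul_one, mul_zero]

lemma norm_map_rightSingularBasis (T : E →ₗ[ℝ] F) (hn : Module.finrank ℝ E = n) (i : Fin n) :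
    ‖T (rightSingularBasis T hn i)‖ = T.singularValues i := by
  rw [← sq_eq_sq₀ (norm_nonneg _) (T.singularValues_nonneg _), ← real_inner_self_eq_norm_sq,
    inner_map_rightSingularBasis, if_pos rfl]

lemma norm_sq_map_eq_sum_singularValues (T : E →ₗ[ℝ] F) (hn : Module.finrank ℝ E = n) (x : E) :
    ‖T x‖ ^ 2 =
      ∑ i : Fin n, T.singularValues i ^ 2 * inner ℝ (rightSingularBasis T hn i) x ^ 2 := by
  rw [← real_inner_self_eq_norm_sq, ← LinearMap.adjoint_inner_right, ← LinearMap.comp_apply]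
  exact inner_map_self_eq_sum _ (adjoint_comp_self_rightSingularBasis T hn) x

lemma norm_map_le_singularValues_zero_mul (T : E →ₗ[ℝ] F) (x : E) :
    ‖T x‖ ≤ T.singularValues 0 * ‖x‖ := by
  have hnonneg := T.singularValues_nonneg
  refine le_of_sq_le_sq ?_ (mul_nonneg (hnonneg 0) (norm_nonneg x))
  rw [mul_pow, norm_sq_map_eq_sum_singularValues T rfl,
    ← (rightSingularBasis T rfl).sum_sq_inner_right x, Finset.mul_sum]
  exact Finset.sum_le_sum fun i _ => mul_le_mul_of_nonneg_right
    (pow_le_pow_left₀ (hnonneg i) (T.singularValues_antitone (Nat.zero_le i)) 2) (sq_nonneg _)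

lemma singularValues_mul_norm_le (T : E →ₗ[ℝ] F) {k : ℕ} (hk : Module.finrank ℝ E ≤ k + 1) (x : E) :
    T.singularValues k * ‖x‖ ≤ ‖T x‖ := by
  have hnonneg := T.singularValues_nonneg
  refine le_of_sq_le_sq ?_ (norm_nonneg _)
  rw [mul_pow, norm_sq_map_eq_sum_singularValues T rfl,
    ← (rightSingularBasis T rfl).sum_sq_inner_right x, Finset.mul_sum]
  exact Finset.sum_le_sum fun i _ => mul_le_mul_of_nonneg_right
    (pow_le_pow_left₀ (hnonneg k) (T.singularValues_antitone (by omega)) 2) (sq_nonneg _)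

end SingularValues

section MatrixSingularValues

variable {d m r : ℕ}

lemma norm_toEuclideanLin_le_sigmaMax (F : Matrix (Fin d) (Fin m) ℝ)
    (x : EuclideanSpace ℝ (Fin m)) : ‖toEuclideanLin F x‖ ≤ sigmaMax F * ‖x‖ :=
  norm_map_le_singularValues_zero_mul _ x

lemma finrank_range_toEuclideanLin (B : Matrix (Fin d) (Fin m) ℝ) :
    Module.finrank ℝ (LinearMap.range (toEuclideanLin B)) = B.rank :=
  (B.rank_eq_finrank_range_toLin (PiLp.basisFun 2 ℝ (Fin d)) (PiLp.basisFun 2 ℝ (Fin m))).symm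

lemma sigmaMin_mul_norm_le {F : Matrix (Fin d) (Fin r) ℝ} (hF : F.rank = r)
    (x : EuclideanSpace ℝ (Fin r)) : sigmaMin F * ‖x‖ ≤ ‖toEuclideanLin F x‖ := by
  have hrd : r ≤ d := by simpa [hF] using F.rank_le_card_height
  refine singularValues_mul_norm_le _ ?_ x
  rw [finrank_euclideanSpace_fin]
  omega

lemma sigmaMin_pos (hr : 1 ≤ r) {F : Matrix (Fin d) (Fin r) ℝ} (hF : F.rank = r) :
    0 < sigmaMin F := by
  have hrd : r ≤ d := by simpa [hF] using F.rank_le_card_height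
  rw [sigmaMin, LinearMap.singularValues_pos_iff_lt_finrank_range,
    finrank_range_toEuclideanLin, hF]
  omega

lemma sigmaMin_le_sigmaMax (F : Matrix (Fin d) (Fin m) ℝ) : sigmaMin F ≤ sigmaMax F :=
  (toEuclideanLin F).singularValues_antitone (Nat.zero_le _)

lemma norm_toEuclideanLin_le_specNorm (N : Matrix (Fin d) (Fin m) ℝ)
    (x : EuclideanSpace ℝ (Fin m)) : ‖toEuclideanLin N x‖ ≤ specNorm N * ‖x‖ :=
  Matrix.l2_opNorm_mulVec N x

open scoped Matrix.Norms.L2Operator in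
lemma specNorm_nonneg (N : Matrix (Fin d) (Fin m) ℝ) : 0 ≤ specNorm N :=
  norm_nonneg N

end MatrixSingularValues

section SingularValueDecomposition

variable {d m r : ℕ}

lemma exists_orthonormalBasis_eq_norm_smul {F : Type*} [NormedAddCommGroup F]
    [InnerProductSpace ℝ F] [FiniteDimensional ℝ F] (hd : Module.finrank ℝ F = d) {u : Fin d → F}
    (hu : Pairwise fun i j => inner ℝ (u i) (u j) = 0) :
    ∃ c : OrthonormalBasis (Fin d) ℝ F, ∀ i, u i = ‖u i‖ • c i := by
  have hcard : Module.finrank ℝ F = Fintype.card (Fin d) := by rw [hd, Fintype.card_fin]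
  refine ⟨InnerProductSpace.gramSchmidtOrthonormalBasis hcard u, fun i => ?_⟩
  obtain h0 | h0 := eq_or_ne (u i) 0
  · simp [h0]
  · rw [InnerProductSpace.gramSchmidtOrthonormalBasis_apply_of_orthogonal hcard hu h0]
    simp [smul_smul, h0]

lemma of_orthonormalBasis_mem_orthogonalGroup
    (c : OrthonormalBasis (Fin d) ℝ (EuclideanSpace ℝ (Fin d))) :
    Matrix.of (fun a i => c i a) ∈ orthogonalGroup (Fin d) ℝ :=
  (EuclideanSpace.basisFun (Fin d) ℝ).toMatrix_orthonormalBasis_mem_unitary c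

/-- The `d × m` diagonal matrix of `IsSVD`. -/
def rectDiagonal (σ : Fin (min d m) → ℝ) : Matrix (Fin d) (Fin m) ℝ :=
  Matrix.of fun i j => if h : i.val = j.val then σ ⟨i.val, lt_min i.isLt (h ▸ j.isLt)⟩ else 0

lemma toEuclideanLin_rectDiagonal_apply (σ : Fin (min d m) → ℝ) (y : EuclideanSpace ℝ (Fin m))
    (i : Fin d) : toEuclideanLin (rectDiagonal σ) y i =
      if h : i.val < m then σ ⟨i, lt_min i.isLt h⟩ * y ⟨i, h⟩ else 0 := by
  simp only [toLpLin_apply, mulVec, dotProduct, rectDiagonal, of_apply, dite_mul, zero_mul]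
  split_ifs with h
  · rw [Finset.sum_eq_single ⟨i, h⟩ (fun j _ hj => dif_neg fun hij => hj (Fin.ext hij.symm))
      (by simp)]
    simp
  · exact Finset.sum_eq_zero fun j _ => dif_neg fun hij : i.val = j.val => h (hij ▸ j.isLt)

lemma mul_rectDiagonal_apply {ι : Type*} (U : Matrix ι (Fin d) ℝ) (σ : Fin (min d m) → ℝ) (i : ι)
    (j : Fin m) : (U * rectDiagonal σ) i j =
      if h : j.val < d then U i ⟨j, h⟩ * σ ⟨j, lt_min h j.isLt⟩ else 0 := by
  simp only [mul_apply, rectDiagonal, of_apply, mul_dite, mul_zero]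
  split_ifs with h
  · rw [Finset.sum_eq_single ⟨j, h⟩ (fun k _ hk => dif_neg fun hkj => hk (Fin.ext hkj)) (by simp)]
    simp
  · exact Finset.sum_eq_zero fun k _ => dif_neg fun hkj : k.val = j.val => h (hkj ▸ k.isLt)

lemma exists_map_rightSingularBasis_eq (A : Matrix (Fin d) (Fin m) ℝ) :
    ∃ c : OrthonormalBasis (Fin d) ℝ (EuclideanSpace ℝ (Fin d)), ∀ j : Fin m,
      toEuclideanLin A (rightSingularBasis (toEuclideanLin A) finrank_euclideanSpace_fin j) =
        if h : j.val < d then (toEuclideanLin A).singularValues j • c ⟨j, h⟩ else 0 := by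
  set T := toEuclideanLin A
  set b := rightSingularBasis T finrank_euclideanSpace_fin with hb
  set u : Fin d → EuclideanSpace ℝ (Fin d) := fun i =>
    if h : i.val < m then T (b ⟨i, h⟩) else 0 with hu
  have horth : Pairwise fun i j => inner ℝ (u i) (u j) = 0 := by
    intro i j hij
    simp only [hu]
    split_ifs with hi hj
    · rw [hb, inner_map_rightSingularBasis, if_neg (by simpa [Fin.ext_iff] using hij)]
    all_goals simp
  obtain ⟨c, hc⟩ := exists_orthonormalBasis_eq_norm_smul finrank_euclideanSpace_fin horth
  refine ⟨c, fun j => ?_⟩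
  split_ifs with h
  · simpa [hu, hb, norm_map_rightSingularBasis] using hc ⟨j, h⟩
  · have hrank := Submodule.finrank_le (LinearMap.range T)
    rw [finrank_euclideanSpace_fin] at hrank
    rw [← norm_eq_zero, hb, norm_map_rightSingularBasis]
    refine le_antisymm (not_lt.mp fun hpos => ?_) (T.singularValues_nonneg _)
    rw [LinearMap.singularValues_pos_iff_lt_finrank_range] at hpos
    omega

theorem exists_isSVD (A : Matrix (Fin d) (Fin m) ℝ) : ∃ U σ V, IsSVD A U σ V := by
  set T := toEuclideanLin A with hT
  set b := rightSingularBasis T finrank_euclideanSpace_fin with hb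
  obtain ⟨c, hc⟩ := exists_map_rightSingularBasis_eq A
  rw [← hT, ← hb] at hc
  set U : Matrix (Fin d) (Fin d) ℝ := Matrix.of fun a i => c i a with hU
  set V : Matrix (Fin m) (Fin m) ℝ := Matrix.of fun a j => b j a with hV
  have hVorth : V ∈ orthogonalGroup (Fin m) ℝ := of_orthonormalBasis_mem_orthogonalGroup b
  refine ⟨U, fun k => T.singularValues k, V, of_orthonormalBasis_mem_orthogonalGroup c, hVorth,
    fun k => T.singularValues_nonneg k, fun i j hij => T.singularValues_antitone hij, ?_⟩
  have hAV : A * V = U * rectDiagonal (d := d) (m := m) fun k => T.singularValues k := by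
    ext a j
    have hcol : (A * V) a j = T (b j) a := by
      simp [hT, hV, toLpLin_apply, mul_apply, mulVec, dotProduct]
    rw [hcol, hc, mul_rectDiagonal_apply]
    split_ifs with h
    · simp [hU, mul_comm]
    · rfl
  change A = U * rectDiagonal (d := d) (m := m) (fun k => T.singularValues k) * Vᵀ
  rw [← hAV, Matrix.mul_assoc, (mem_orthogonalGroup_iff (Fin m) ℝ).mp hVorth, Matrix.mul_one]

lemma norm_sq_toEuclideanLin_rectDiagonal (σ : Fin (min d m) → ℝ)
    (y : EuclideanSpace ℝ (Fin m)) : ‖toEuclideanLin (rectDiagonal σ) y‖ ^ 2 =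
      ∑ k, (σ k * y (Fin.castLE (min_le_right d m) k)) ^ 2 := by
  rw [EuclideanSpace.real_norm_sq_eq]
  symm
  refine Fintype.sum_of_injective (Fin.castLE (min_le_left d m)) (Fin.castLE_injective _) _ _
    (fun i hi => ?_) fun k => ?_
  · have him : ¬ i.val < m := fun h => hi ⟨⟨i, lt_min i.isLt h⟩, rfl⟩
    rw [toEuclideanLin_rectDiagonal_apply, dif_neg him, zero_pow two_ne_zero]
  · have hkm : k.val < m := k.isLt.trans_le (min_le_right d m)
    rw [toEuclideanLin_rectDiagonal_apply, dif_pos (by simpa using hkm)]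
    rfl

lemma norm_toEuclideanLin_of_transpose_mul_self {B : Matrix (Fin d) (Fin m) ℝ} (hB : Bᵀ * B = 1)
    (x : EuclideanSpace ℝ (Fin m)) : ‖toEuclideanLin B x‖ = ‖x‖ := by
  rw [← sq_eq_sq₀ (norm_nonneg _) (norm_nonneg _), ← inner_toEuclideanLin_transpose_mul_self, hB,
    toLpLin_one, LinearMap.id_apply, real_inner_self_eq_norm_sq]

variable {A : Matrix (Fin d) (Fin m) ℝ} {U : Matrix (Fin d) (Fin d) ℝ}
  {σ : Fin (min d m) → ℝ} {V : Matrix (Fin m) (Fin m) ℝ}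

lemma IsSVD.norm_toEuclideanLin_transpose_right (h : IsSVD A U σ V)
    (x : EuclideanSpace ℝ (Fin m)) : ‖toEuclideanLin Vᵀ x‖ = ‖x‖ :=
  norm_toEuclideanLin_of_transpose_mul_self (B := Vᵀ)
    ((mem_orthogonalGroup_iff (Fin m) ℝ).mp h.right_orthogonal) x

lemma IsSVD.norm_sq_apply (h : IsSVD A U σ V) (x : EuclideanSpace ℝ (Fin m)) :
    ‖toEuclideanLin A x‖ ^ 2 =
      ∑ k, (σ k * toEuclideanLin Vᵀ x (Fin.castLE (min_le_right d m) k)) ^ 2 := by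
  have hA : A = U * rectDiagonal σ * Vᵀ := h.eq_mul
  rw [hA, toLpLin_mul_same, toLpLin_mul_same, LinearMap.comp_apply, LinearMap.comp_apply,
    norm_toEuclideanLin_of_transpose_mul_self
      ((mem_orthogonalGroup_iff' (Fin d) ℝ).mp h.left_orthogonal),
    norm_sq_toEuclideanLin_rectDiagonal]

lemma norm_sq_toEuclideanLin_reduced (hr : r ≤ min d m) (σ : Fin (min d m) → ℝ)
    (V : Matrix (Fin m) (Fin m) ℝ) (x : EuclideanSpace ℝ (Fin m)) :
    ‖toEuclideanLin (reduced hr σ V) x‖ ^ 2 = ∑ k with k.val < r,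
      (σ k * toEuclideanLin Vᵀ x (Fin.castLE (min_le_right d m) k)) ^ 2 := by
  have happly : ∀ k, toEuclideanLin (reduced hr σ V) x k = σ (Fin.castLE hr k) *
      toEuclideanLin Vᵀ x (Fin.castLE (hr.trans (min_le_right d m)) k) := fun k => by
    rw [reduced, toLpLin_mul_same]
    exact mulVec_diagonal _ _ k
  rw [EuclideanSpace.real_norm_sq_eq, Finset.sum_filter]
  refine Fintype.sum_of_injective (Fin.castLE hr) (Fin.castLE_injective _) _ _
    (fun i hi => if_neg fun h => hi ⟨⟨i, h⟩, rfl⟩) fun k => ?_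
  rw [happly, if_pos (by simp)]
  rfl

lemma sum_sq_castLE_le (h : d ≤ m) (y : EuclideanSpace ℝ (Fin m)) :
    ∑ k : Fin d, y (Fin.castLE h k) ^ 2 ≤ ‖y‖ ^ 2 := by
  rw [EuclideanSpace.real_norm_sq_eq, ← Finset.sum_image (f := fun j => y j ^ 2)
    (Fin.castLE_injective h).injOn]
  exact Finset.sum_le_univ_sum_of_nonneg fun j => sq_nonneg _

lemma IsSVD.norm_reduced_le (h : IsSVD A U σ V) (hr : r ≤ min d m)
    (x : EuclideanSpace ℝ (Fin m)) :
    ‖toEuclideanLin (reduced hr σ V) x‖ ≤ ‖toEuclideanLin A x‖ := by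
  refine le_of_sq_le_sq ?_ (norm_nonneg _)
  rw [norm_sq_toEuclideanLin_reduced, h.norm_sq_apply]
  exact Finset.sum_le_sum_of_subset_of_nonneg (Finset.filter_subset _ _) fun k _ _ => sq_nonneg _

lemma IsSVD.norm_apply_le_norm_reduced_add (h : IsSVD A U σ V) (hr : r ≤ min d m) {ε : ℝ}
    (hσ : ∀ k, r ≤ k.val → σ k ≤ ε) (hε : 0 ≤ ε) (x : EuclideanSpace ℝ (Fin m)) :
    ‖toEuclideanLin A x‖ ≤ ‖toEuclideanLin (reduced hr σ V) x‖ + ε * ‖x‖ := by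
  set y := toEuclideanLin Vᵀ x with hy
  have htail : ∑ k with ¬ k.val < r, (σ k * y (Fin.castLE (min_le_right d m) k)) ^ 2 ≤
      (ε * ‖x‖) ^ 2 := by
    calc ∑ k with ¬ k.val < r, (σ k * y (Fin.castLE (min_le_right d m) k)) ^ 2
        ≤ ∑ k with ¬ k.val < r, ε ^ 2 * y (Fin.castLE (min_le_right d m) k) ^ 2 := by
          refine Finset.sum_le_sum fun k hk => ?_
          rw [mul_pow]
          exact mul_le_mul_of_nonneg_right (pow_le_pow_left₀ (h.nonneg k)
            (hσ k (not_lt.mp (Finset.mem_filter.mp hk).2)) 2) (sq_nonneg _)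
      _ ≤ ∑ k, ε ^ 2 * y (Fin.castLE (min_le_right d m) k) ^ 2 :=
          Finset.sum_le_sum_of_subset_of_nonneg (Finset.filter_subset _ _)
            fun k _ _ => by positivity
      _ ≤ ε ^ 2 * ‖y‖ ^ 2 := by
          rw [← Finset.mul_sum]
          exact mul_le_mul_of_nonneg_left (sum_sq_castLE_le _ y) (sq_nonneg ε)
      _ = (ε * ‖x‖) ^ 2 := by
          rw [hy, h.norm_toEuclideanLin_transpose_right, mul_pow]
  refine le_of_sq_le_sq ?_ (by positivity)
  rw [h.norm_sq_apply, ← Finset.sum_filter_add_sum_filter_not _ (fun k => k.val < r),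
    ← norm_sq_toEuclideanLin_reduced hr]
  nlinarith [mul_nonneg (norm_nonneg (toEuclideanLin (reduced hr σ V) x))
    (mul_nonneg hε (norm_nonneg x))]

lemma IsSVD.mul_norm_le (h : IsSVD A U σ V) (k : Fin (min d m)) {x : EuclideanSpace ℝ (Fin m)}
    (hx : ∀ j : Fin m, k.val < j → toEuclideanLin Vᵀ x j = 0) :
    σ k * ‖x‖ ≤ ‖toEuclideanLin A x‖ := by
  set y := toEuclideanLin Vᵀ x with hy
  have hnorm : ∑ j, y (Fin.castLE (min_le_right d m) j) ^ 2 = ‖x‖ ^ 2 := by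
    rw [← h.norm_toEuclideanLin_transpose_right, EuclideanSpace.real_norm_sq_eq]
    refine Fintype.sum_of_injective _ (Fin.castLE_injective _) _ _ (fun j hj => ?_) fun _ => rfl
    have hkj : k.val < j := by
      by_contra! hjk
      exact hj ⟨⟨j, hjk.trans_lt k.isLt⟩, rfl⟩
    rw [← hy, hx j hkj, zero_pow two_ne_zero]
  refine le_of_sq_le_sq ?_ (norm_nonneg _)
  rw [h.norm_sq_apply, mul_pow, ← hnorm, Finset.mul_sum]
  refine Finset.sum_le_sum fun j _ => ?_
  rw [mul_pow]
  obtain hjk | hkj := le_or_gt j k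
  · exact mul_le_mul_of_nonneg_right (pow_le_pow_left₀ (h.nonneg k) (h.antitone hjk) 2)
      (sq_nonneg _)
  · rw [hx _ hkj, zero_pow two_ne_zero, mul_zero, mul_zero]

lemma exists_ne_zero_map_eq_zero_of_rank_le {B : Matrix (Fin d) (Fin m) ℝ} (k : Fin m)
    (hB : B.rank ≤ k) (V : Matrix (Fin m) (Fin m) ℝ) :
    ∃ x : EuclideanSpace ℝ (Fin m), x ≠ 0 ∧ toEuclideanLin B x = 0 ∧
      ∀ j, k < j → toEuclideanLin Vᵀ x j = 0 := by
  let coords : EuclideanSpace ℝ (Fin m) →ₗ[ℝ] Finset.Ioi k → ℝ :=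
    LinearMap.pi fun j => (EuclideanSpace.proj (𝕜 := ℝ) j.val).toLinearMap ∘ₗ toEuclideanLin Vᵀ
  have hdim : Module.finrank ℝ (LinearMap.range (toEuclideanLin B) × (Finset.Ioi k → ℝ)) <
      Module.finrank ℝ (EuclideanSpace ℝ (Fin m)) := by
    rw [Module.finrank_prod, Module.finrank_fintype_fun_eq_card, Fintype.card_coe, Fin.card_Ioi,
      finrank_euclideanSpace_fin, finrank_range_toEuclideanLin]
    omega
  obtain ⟨x, hx, hx0⟩ := Submodule.exists_mem_ne_zero_of_ne_bot
    (LinearMap.ker_ne_bot_of_finrank_lt (f := (toEuclideanLin B).rangeRestrict.prod coords) hdim)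
  obtain ⟨hBx, hVx⟩ := Prod.ext_iff.mp (LinearMap.mem_ker.mp hx)
  exact ⟨x, hx0, congrArg Subtype.val hBx, fun j hj => congrFun hVx ⟨j, Finset.mem_Ioi.mpr hj⟩⟩

theorem IsSVD.le_specNorm_sub (h : IsSVD A U σ V) (k : Fin (min d m))
    {B : Matrix (Fin d) (Fin m) ℝ} (hB : B.rank ≤ k) : σ k ≤ specNorm (A - B) := by
  obtain ⟨x, hx, hBx, hVx⟩ := exists_ne_zero_map_eq_zero_of_rank_le
    (Fin.castLE (min_le_right d m) k) hB V
  refine le_of_mul_le_mul_right ((h.mul_norm_le k hVx).trans ?_) (norm_pos_iff.mpr hx)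
  simpa [hBx] using norm_toEuclideanLin_le_specNorm (A - B) x

/-- `P` is shorter than `A` on every vector, by at most `ε` times the norm of the vector: up to an
error `ε`, the columns of `P` have the geometry of those of `A`. -/
structure IsCompression {n : ℕ} (A : Matrix (Fin d) (Fin m) ℝ) (P : Matrix (Fin n) (Fin m) ℝ)
    (ε : ℝ) : Prop where
  norm_le : ∀ x, ‖toEuclideanLin P x‖ ≤ ‖toEuclideanLin A x‖
  norm_le_add : ∀ x, ‖toEuclideanLin A x‖ ≤ ‖toEuclideanLin P x‖ + ε * ‖x‖

theorem IsSVD.isCompression_reduced (h : IsSVD A U σ V) (hr : r ≤ min d m)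
    {B : Matrix (Fin d) (Fin m) ℝ} (hB : B.rank ≤ r) :
    IsCompression A (reduced hr σ V) (specNorm (A - B)) where
  norm_le := h.norm_reduced_le hr
  norm_le_add := h.norm_apply_le_norm_reduced_add hr
    (fun k hk => h.le_specNorm_sub k (hB.trans hk)) (specNorm_nonneg _)

end SingularValueDecomposition

section SeparableData

variable {d m r n : ℕ}

lemma SeparableWith.exists_factor {A : Matrix (Fin d) (Fin m) ℝ} {F : Matrix (Fin d) (Fin r) ℝ}
    (h : SeparableWith A F) : ∃ (W : Matrix (Fin r) (Fin m) ℝ) (v : Fin r → Fin m),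
      A = F * W ∧ (∀ i, col W i ∈ solidSimplex (Fin r)) ∧ W.submatrix id v = 1 := by
  obtain ⟨-, K, e, hK0, hK1, hA⟩ := h
  refine ⟨_, fun j => e.symm (Sum.inl j), hA, fun i => ?_, ?_⟩
  · simp only [solidSimplex, Set.mem_ofPred_eq, col, submatrix_apply, id]
    obtain j | j := e i
    · simp only [fromCols_apply_inl, one_apply, Finset.sum_ite_eq', Finset.mem_univ, if_true,
        le_refl, and_true]
      exact fun k => by split_ifs <;> norm_num
    · exact ⟨fun k => hK0 k j, hK1 j⟩
  · ext k j
    simp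

lemma injective_of_submatrix_eq_one {W : Matrix (Fin r) (Fin m) ℝ} {v : Fin r → Fin m}
    (hWv : W.submatrix id v = 1) : Function.Injective v := by
  intro j k hjk
  by_contra hne
  have hj := congrFun₂ hWv j j
  have hk := congrFun₂ hWv j k
  rw [submatrix_apply, one_apply_eq] at hj
  rw [submatrix_apply, one_apply_ne hne, ← hjk, hj] at hk
  exact one_ne_zero hk

lemma SeparableWith.le_min_dim {A : Matrix (Fin d) (Fin m) ℝ} {F : Matrix (Fin d) (Fin r) ℝ}
    (h : SeparableWith A F) : r ≤ min d m := by
  obtain ⟨W, v, -, -, hWv⟩ := h.exists_factor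
  refine le_min ?_ ?_
  · simpa [h.1] using F.rank_le_card_height
  · simpa using Fintype.card_le_of_injective v (injective_of_submatrix_eq_one hWv)

lemma toEuclideanLin_single (M : Matrix (Fin d) (Fin m) ℝ) (i : Fin m) :
    toEuclideanLin M (EuclideanSpace.single i 1) = col M i := by
  ext a
  simp [col]

/-- Multiplication by `selectionMatrix v` on the right selects the columns `v`. -/
def selectionMatrix (v : Fin r → Fin m) : Matrix (Fin m) (Fin r) ℝ :=
  (1 : Matrix (Fin m) (Fin m) ℝ).submatrix id v

lemma mul_selectionMatrix (M : Matrix (Fin d) (Fin m) ℝ) (v : Fin r → Fin m) :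
    M * selectionMatrix v = M.submatrix id v := by
  simpa only [selectionMatrix, Matrix.mul_one, submatrix_id_id] using
    (submatrix_mul M 1 id id v Function.bijective_id).symm

lemma toEuclideanLin_submatrix (M : Matrix (Fin d) (Fin m) ℝ) (v : Fin r → Fin m)
    (x : EuclideanSpace ℝ (Fin r)) : toEuclideanLin (M.submatrix id v) x =
      toEuclideanLin M (toEuclideanLin (selectionMatrix v) x) := by
  rw [← mul_selectionMatrix, toLpLin_mul_same, LinearMap.comp_apply]

lemma norm_toEuclideanLin_selectionMatrix {v : Fin r → Fin m} (hv : Function.Injective v)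
    (x : EuclideanSpace ℝ (Fin r)) : ‖toEuclideanLin (selectionMatrix v) x‖ = ‖x‖ := by
  refine norm_toEuclideanLin_of_transpose_mul_self ?_ x
  rw [mul_selectionMatrix, selectionMatrix, transpose_submatrix, submatrix_submatrix,
    transpose_one]
  exact submatrix_one v hv

variable {F : Matrix (Fin d) (Fin r) ℝ} {W : Matrix (Fin r) (Fin m) ℝ}
  {N : Matrix (Fin d) (Fin m) ℝ} {P : Matrix (Fin n) (Fin m) ℝ} {v : Fin r → Fin m}

lemma toEuclideanLin_factor_selectionMatrix (F : Matrix (Fin d) (Fin r) ℝ)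
    (N : Matrix (Fin d) (Fin m) ℝ) (hWv : W.submatrix id v = 1) (x : EuclideanSpace ℝ (Fin r)) :
    toEuclideanLin (F * W + N) (toEuclideanLin (selectionMatrix v) x) =
      toEuclideanLin F x + toEuclideanLin N (toEuclideanLin (selectionMatrix v) x) := by
  rw [map_add, LinearMap.add_apply, ← LinearMap.comp_apply, ← toLpLin_mul_same,
    Matrix.mul_assoc, mul_selectionMatrix, hWv, Matrix.mul_one]

lemma IsCompression.norm_factor_le (hP : IsCompression (F * W + N) P (specNorm N))
    (hWv : W.submatrix id v = 1) (x : EuclideanSpace ℝ (Fin r)) :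
    ‖toEuclideanLin F x‖ ≤ ‖toEuclideanLin (P.submatrix id v) x‖ + 2 * specNorm N * ‖x‖ := by
  have hx := norm_toEuclideanLin_selectionMatrix (injective_of_submatrix_eq_one hWv) x
  have hcompress := hP.norm_le_add (toEuclideanLin (selectionMatrix v) x)
  have hnoise := norm_toEuclideanLin_le_specNorm N (toEuclideanLin (selectionMatrix v) x)
  rw [toEuclideanLin_factor_selectionMatrix F N hWv, ← toEuclideanLin_submatrix P, hx] at hcompress
  rw [hx] at hnoise
  linarith [norm_le_add_norm_add (toEuclideanLin F x)
    (toEuclideanLin N (toEuclideanLin (selectionMatrix v) x))]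

lemma IsCompression.norm_submatrix_le (hP : IsCompression (F * W + N) P (specNorm N))
    (hWv : W.submatrix id v = 1) (x : EuclideanSpace ℝ (Fin r)) :
    ‖toEuclideanLin (P.submatrix id v) x‖ ≤ (sigmaMax F + specNorm N) * ‖x‖ := by
  have hx := norm_toEuclideanLin_selectionMatrix (injective_of_submatrix_eq_one hWv) x
  rw [toEuclideanLin_submatrix, add_mul]
  refine (hP.norm_le _).trans ?_
  rw [toEuclideanLin_factor_selectionMatrix F N hWv]
  exact norm_add_le_of_le (norm_toEuclideanLin_le_sigmaMax F x)
    (hx ▸ norm_toEuclideanLin_le_specNorm N _)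

lemma IsCompression.norm_col_sub_submatrix_le (hP : IsCompression (F * W + N) P (specNorm N))
    (hWv : W.submatrix id v = 1) {i : Fin m} (hi : col W i ∈ solidSimplex (Fin r)) :
    ‖col P i - toEuclideanLin (P.submatrix id v) (col W i)‖ ≤ 2 * specNorm N := by
  set y := EuclideanSpace.single i 1 - toEuclideanLin (selectionMatrix v) (col W i) with hy
  have hnorm : ‖y‖ ≤ 2 := by
    have hw := norm_le_one_of_mem_solidSimplex hi
    rw [← norm_toEuclideanLin_selectionMatrix (injective_of_submatrix_eq_one hWv)] at hw
    refine (norm_sub_le _ _).trans ?_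
    rw [PiLp.norm_single, norm_one]
    linarith
  have hPy : col P i - toEuclideanLin (P.submatrix id v) (col W i) = toEuclideanLin P y := by
    rw [hy, map_sub, toEuclideanLin_single, toEuclideanLin_submatrix]
  have hAy : toEuclideanLin (F * W + N) y = toEuclideanLin N y := by
    rw [hy, map_sub _ (EuclideanSpace.single i 1), toEuclideanLin_factor_selectionMatrix F N hWv,
      map_add toEuclideanLin, LinearMap.add_apply, toEuclideanLin_single, col_mul, map_sub]
    abel
  rw [hPy]
  refine (hP.norm_le y).trans ?_
  rw [hAy, mul_comm]
  exact (norm_toEuclideanLin_le_specNorm N y).trans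
    (mul_le_mul_of_nonneg_left hnorm (specNorm_nonneg N))

lemma IsCompression.norm_col_sub_col_le (hP : IsCompression (F * W + N) P (specNorm N))
    (hWv : W.submatrix id v = 1) (i : Fin m) (j : Fin r) :
    ‖col (F * W + N) i - col F j‖ ≤ ‖col P i - col P (v j)‖ + 3 * specNorm N := by
  set y : EuclideanSpace ℝ (Fin m) := EuclideanSpace.single i 1 - EuclideanSpace.single (v j) 1
  have hnorm : ‖y‖ ≤ 2 := by
    refine (norm_sub_le _ _).trans ?_
    simp only [PiLp.norm_single, norm_one]
    norm_num
  have hcompress := hP.norm_le_add y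
  have hy := mul_le_mul_of_nonneg_left hnorm (specNorm_nonneg N)
  have hnoise : ‖col N (v j)‖ ≤ specNorm N := by
    simpa [toEuclideanLin_single] using
      norm_toEuclideanLin_le_specNorm N (EuclideanSpace.single (v j) 1)
  have hF : col (F * W + N) (v j) = col F j + col N (v j) := by
    have hW : col W (v j) = EuclideanSpace.single j 1 := by
      ext k
      simpa [col, one_apply] using congrFun₂ hWv k j
    rw [← toEuclideanLin_single, map_add, LinearMap.add_apply, toEuclideanLin_single,
      toEuclideanLin_single, col_mul, hW, toEuclideanLin_single]
  rw [map_sub, map_sub, toEuclideanLin_single, toEuclideanLin_single, toEuclideanLin_single,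
    toEuclideanLin_single, hF, ← sub_sub] at hcompress
  linarith [norm_le_add_norm_add (col (F * W + N) i - col F j - col N (v j)) (col N (v j)),
    norm_sub_norm_le (col (F * W + N) i - col F j) (col N (v j))]

end SeparableData

section PreconditionedSPA

variable {d m r : ℕ}

/-- The coordinates of the `i`-th column of `P` in the basis formed by the columns `v`. -/
noncomputable def columnCoords (P : Matrix (Fin r) (Fin m) ℝ) (v : Fin r → Fin m) (i : Fin m) :
    EuclideanSpace ℝ (Fin r) :=
  toEuclideanLin (P.submatrix id v)⁻¹ (col P i)

lemma toEuclideanLin_columnCoords {P : Matrix (Fin r) (Fin m) ℝ} {v : Fin r → Fin m}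
    (hv : IsUnit (P.submatrix id v)) (i : Fin m) :
    toEuclideanLin (P.submatrix id v) (columnCoords P v i) = col P i := by
  rw [columnCoords, ← LinearMap.comp_apply, ← toLpLin_mul_same,
    mul_nonsing_inv _ ((isUnit_iff_isUnit_det _).mp hv), toLpLin_one, LinearMap.id_apply]

lemma columnCoords_apply_self {P : Matrix (Fin r) (Fin m) ℝ} {v : Fin r → Fin m}
    (hv : IsUnit (P.submatrix id v)) (j : Fin r) :
    columnCoords P v (v j) = EuclideanSpace.single j 1 := by
  have hcol : col P (v j) = toEuclideanLin (P.submatrix id v) (EuclideanSpace.single j 1) :=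
    (toEuclideanLin_single (P.submatrix id v) j).symm
  rw [columnCoords, hcol, ← LinearMap.comp_apply, ← toLpLin_mul_same,
    nonsing_inv_mul _ ((isUnit_iff_isUnit_det _).mp hv), toLpLin_one, LinearMap.id_apply]

lemma isUnit_of_mul_norm_le {G : Matrix (Fin r) (Fin r) ℝ} {a : ℝ} (ha : 0 < a)
    (hG : ∀ x, a * ‖x‖ ≤ ‖toEuclideanLin G x‖) : IsUnit G := by
  refine mulVec_injective_iff_isUnit.mp fun x y hxy => ?_
  have h := hG (WithLp.toLp 2 (x - y))
  rw [toLpLin_apply, mulVec_sub, sub_eq_zero.mpr hxy, WithLp.toLp_zero, norm_zero] at h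
  have hnorm := nonpos_of_mul_nonpos_right h ha
  simpa [sub_eq_zero] using hnorm

lemma isNearSimplex_columnCoords {P : Matrix (Fin r) (Fin m) ℝ} {v : Fin r → Fin m} {a η : ℝ}
    (ha : 0 < a) (hlower : ∀ x, a * ‖x‖ ≤ ‖toEuclideanLin (P.submatrix id v) x‖)
    (hnear : ∀ i, ∃ w ∈ solidSimplex (Fin r),
      ‖col P i - toEuclideanLin (P.submatrix id v) w‖ ≤ η) :
    IsNearSimplex (columnCoords P v) v (η / a) where
  near i := by
    obtain ⟨w, hw, hiw⟩ := hnear i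
    refine ⟨w, hw, ?_⟩
    rw [le_div_iff₀' ha]
    refine (hlower _).trans ?_
    rwa [map_sub, toEuclideanLin_columnCoords (isUnit_of_mul_norm_le ha hlower)]
  vertex := columnCoords_apply_self (isUnit_of_mul_norm_le ha hlower)

lemma exists_ellipsoidOptimal_of_isUnit_submatrix {P : Matrix (Fin r) (Fin m) ℝ}
    {v : Fin r → Fin m} (hv : IsUnit (P.submatrix id v)) : ∃ L, EllipsoidOptimal P L := by
  refine exists_ellipsoidOptimal (R := selectionMatrix v * (P.submatrix id v)⁻¹) ?_
  rw [← Matrix.mul_assoc, mul_selectionMatrix,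
    mul_nonsing_inv _ ((isUnit_iff_isUnit_det _).mp hv)]

open scoped MatrixOrder in
theorem EllipsoidOptimal.spaReturns_sqrt_mul {P : Matrix (Fin r) (Fin m) ℝ}
    {L : Matrix (Fin r) (Fin r) ℝ} (hL : EllipsoidOptimal P L) {v : Fin r → Fin m}
    (hv : IsUnit (P.submatrix id v)) {δ : ℝ} (hq : IsNearSimplex (columnCoords P v) v δ)
    (hδ0 : 0 ≤ δ) (hδ : δ * r ≤ 1 / 20000) :
    SPAReturns (CFC.sqrt L * P) r fun I => ∃ idx : Fin r → Fin m, Function.Injective idx ∧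
      Finset.univ.image idx = I ∧
        ∀ j, ‖columnCoords P v (idx j) - EuclideanSpace.single j 1‖ ≤ 1026 * δ := by
  have hlog : 2 * r * Real.log (1 + δ) ≤ 19 / 100 := by
    have hle : Real.log (1 + δ) ≤ δ := by
      linarith [Real.log_le_sub_one_of_pos (show 0 < 1 + δ by positivity)]
    nlinarith [mul_le_mul_of_nonneg_left hle (Nat.cast_nonneg (α := ℝ) r)]
  have hsqrt : √(r : ℝ) ≤ r :=
    Real.sqrt_le_iff.mpr ⟨r.cast_nonneg, by exact_mod_cast Nat.le_self_pow two_ne_zero r⟩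
  have hbounds := hL.norm_factor_mul_bounds hv (by positivity) hq.norm_le hlog
    (transpose_sqrt_mul_sqrt hL.1.1.posSemidef)
  refine spaReturns_of_isNearSimplex hq ((mul_le_mul_of_nonneg_left hsqrt hδ0).trans hδ)
    (fun i => ?_) (fun x => (hbounds x).1) fun x => (hbounds x).2
  rw [col_mul, toLpLin_mul_same, LinearMap.comp_apply, toEuclideanLin_columnCoords hv]

variable {N : Matrix (Fin d) (Fin m) ℝ} {F : Matrix (Fin d) (Fin r) ℝ}
  {W : Matrix (Fin r) (Fin m) ℝ} {P : Matrix (Fin r) (Fin m) ℝ} {v : Fin r → Fin m}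

lemma IsCompression.half_sigmaMin_mul_norm_le (hP : IsCompression (F * W + N) P (specNorm N))
    (hWv : W.submatrix id v = 1) (hF : F.rank = r) (hN : 4 * specNorm N ≤ sigmaMin F)
    (x : EuclideanSpace ℝ (Fin r)) :
    sigmaMin F / 2 * ‖x‖ ≤ ‖toEuclideanLin (P.submatrix id v) x‖ := by
  have hnoise := mul_le_mul_of_nonneg_right hN (norm_nonneg x)
  linarith [sigmaMin_mul_norm_le hF x, hP.norm_factor_le hWv x]

lemma IsCompression.isNearSimplex_columnCoords
    (hP : IsCompression (F * W + N) P (specNorm N)) (hWv : W.submatrix id v = 1)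
    (hW : ∀ i, col W i ∈ solidSimplex (Fin r)) (hF : F.rank = r) (hpos : 0 < sigmaMin F)
    (hN : 4 * specNorm N ≤ sigmaMin F) :
    IsNearSimplex (columnCoords P v) v (4 * (specNorm N / sigmaMin F)) := by
  convert PrecondSPA.isNearSimplex_columnCoords (half_pos hpos)
    (hP.half_sigmaMin_mul_norm_le hWv hF hN)
    (fun i => ⟨col W i, hW i, hP.norm_col_sub_submatrix_le hWv (hW i)⟩) using 1
  ring

lemma IsCompression.norm_col_sub_le_cond_mul (hP : IsCompression (F * W + N) P (specNorm N))
    (hWv : W.submatrix id v = 1) (hv : IsUnit (P.submatrix id v)) (hpos : 0 < sigmaMin F)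
    (hN : specNorm N ≤ sigmaMin F) {t : ℝ} {i : Fin m} {j : Fin r}
    (hij : ‖columnCoords P v i - EuclideanSpace.single j 1‖ ≤ t * (specNorm N / sigmaMin F)) :
    ‖col (F * W + N) i - col F j‖ ≤ (2 * t + 3) * (cond F * specNorm N) := by
  have hε := specNorm_nonneg N
  have hσ := sigmaMin_le_sigmaMax F
  have hcond : 1 ≤ cond F := (one_le_div hpos).mpr hσ
  have hcols : ‖col P i - col P (v j)‖ ≤ 2 * t * (cond F * specNorm N) := by
    rw [← toEuclideanLin_columnCoords hv i, ← toEuclideanLin_columnCoords hv (v j),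
      columnCoords_apply_self hv j, ← map_sub]
    calc ‖toEuclideanLin (P.submatrix id v) (columnCoords P v i - EuclideanSpace.single j 1)‖
        ≤ (sigmaMax F + specNorm N) * ‖columnCoords P v i - EuclideanSpace.single j 1‖ :=
          hP.norm_submatrix_le hWv _
      _ ≤ 2 * sigmaMax F * (t * (specNorm N / sigmaMin F)) :=
          mul_le_mul (by linarith) hij (norm_nonneg _) (by linarith)
      _ = 2 * t * (cond F * specNorm N) := by rw [cond]; ring
  linarith [hP.norm_col_sub_col_le hWv i j, le_mul_of_one_le_left hε hcond]

open scoped MatrixOrder in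
theorem IsCompression.exists_ellipsoidOptimal_and_spaReturns
    (hP : IsCompression (F * W + N) P (specNorm N)) (hWv : W.submatrix id v = 1)
    (hW : ∀ i, col W i ∈ solidSimplex (Fin r)) (hr : 1 ≤ r) (hF : F.rank = r)
    (hN : specNorm N ≤ 1 / 80000 * (sigmaMin F / r)) :
    (∃ L, EllipsoidOptimal P L) ∧ ∀ L, EllipsoidOptimal P L →
      SPAReturns (CFC.sqrt L * P) r fun I => ∃ idx : Fin r → Fin m, Function.Injective idx ∧
        Finset.univ.image idx = I ∧
          basisError (F * W + N) F idx ≤ 8211 * (cond F * specNorm N) := by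
  have hε := specNorm_nonneg N
  have hpos : 0 < sigmaMin F := sigmaMin_pos hr hF
  have hr1 : (1 : ℝ) ≤ r := by exact_mod_cast hr
  have hrN : specNorm N * r ≤ 1 / 80000 * sigmaMin F := by
    rwa [← mul_div_assoc, le_div_iff₀ (by positivity)] at hN
  have hsmall : 4 * specNorm N ≤ sigmaMin F := by linarith [le_mul_of_one_le_right hε hr1]
  have hδ : 4 * (specNorm N / sigmaMin F) * r ≤ 1 / 20000 := by
    rw [← mul_div_assoc, div_mul_eq_mul_div, div_le_iff₀ hpos]
    linarith
  have hv := isUnit_of_mul_norm_le (half_pos hpos) (hP.half_sigmaMin_mul_norm_le hWv hF hsmall)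
  have hq := hP.isNearSimplex_columnCoords hWv hW hF hpos hsmall
  refine ⟨exists_ellipsoidOptimal_of_isUnit_submatrix hv, fun L hL => SPALoop.mono ?_
    (hL.spaReturns_sqrt_mul hv hq (by positivity) hδ)⟩
  rintro I ⟨idx, hinj, himage, hidx⟩
  have : Nonempty (Fin r) := ⟨⟨0, hr⟩⟩
  refine ⟨idx, hinj, himage, ciSup_le fun j => ?_⟩
  calc ‖col (F * W + N) (idx j) - col F j‖
      ≤ (2 * (1026 * 4) + 3) * (cond F * specNorm N) :=
        hP.norm_col_sub_le_cond_mul hWv hv hpos (by linarith)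
          ((hidx j).trans_eq (mul_assoc _ _ _).symm)
    _ = 8211 * (cond F * specNorm N) := by norm_num

end PreconditionedSPA

end PrecondSPA

open PrecondSPA in
theorem mainTheorem2_general :
    ∃ c : ℝ, 0 < c ∧ ∃ C : ℝ, 0 < C ∧
      ∀ (d m r : ℕ), 1 ≤ r →
      ∀ (A N : Matrix (Fin d) (Fin m) ℝ) (F : Matrix (Fin d) (Fin r) ℝ),
        SeparableWith A F →
        ∀ ε : ℝ, specNorm N = ε → ε ≤ c * (sigmaMin F / r) →
          PrecondSPAReturns (A + N) r (fun I =>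
            ∃ idx : Fin r → Fin m, Function.Injective idx ∧ Finset.univ.image idx = I ∧
              basisError (A + N) F idx ≤ C * (cond F * ε)) := by
  refine ⟨1 / 80000, by norm_num, 8211, by norm_num, fun d m r hr A N F hA _ hε hle => ?_⟩
  subst hε
  have hF : F.rank = r := hA.1
  have hrdm : r ≤ min d m := hA.le_min_dim
  obtain ⟨W, v, rfl, hW, hWv⟩ := hA.exists_factor
  refine ⟨hrdm, exists_isSVD _, fun U σ V hSVD => ?_⟩
  have hP : IsCompression (F * W + N) (reduced hrdm σ V) (specNorm N) := by
    simpa only [add_sub_cancel_left] using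
      hSVD.isCompression_reduced hrdm ((F.rank_mul_le_left W).trans_eq hF)
  exact hP.exists_ellipsoidOptimal_and_spaReturns hWv hW hr hF hle

open PrecondSPA in
theorem mainTheorem2 :
    ∃ c : ℝ, 0 < c ∧ ∃ C : ℝ, 0 < C ∧
      ∀ (d m r : ℕ), 1 ≤ r →
      ∀ (A N : Matrix (Fin d) (Fin m) ℝ) (F : Matrix (Fin d) (Fin r) ℝ),
        SeparableWith A F →
        ∀ ε : ℝ, specNorm N = ε → ε ≤ c * (sigmaMin F / (r * Real.sqrt r)) →
          PrecondSPAReturns (A + N) r (fun I =>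
            ∃ idx : Fin r → Fin m, Function.Injective idx ∧ Finset.univ.image idx = I ∧
              basisError (A + N) F idx ≤ C * (cond F * ε)) := by
  obtain ⟨c, hc, C, hC, h⟩ := mainTheorem2_general
  refine ⟨c, hc, C, hC, fun d m r hr A N F hA ε hε hle => h d m r hr A N F hA ε hε (hle.trans ?_)⟩
  have hr1 : (1 : ℝ) ≤ r := by exact_mod_cast hr
  have hσ := sigmaMin_pos hr hA.1
  gcongr
  exact le_mul_of_one_le_right (by positivity) (Real.one_le_sqrt.mpr hr1)
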